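/- **Setting.** For reals $a\le b$, a continuous t-norm on $[a,b]$ is a continuous map $*\colon[a,b]^2\to[a,b]$ that is monotone in both arguments and such that $([a,b],*,b)$ is a commutative monoid. Two continuous t-norms are isomorphic, written $\cong_t$, if there is an order isomorphism between their intervals that is an isomorphism of monoids. Let $\mathcal T$ be the set of continuous t-norms on $[0,1]$ with the sup metric (a Polish space). Let $L_1=\{<,R_P,R_{\text{Ł}},R_M\}$ be the relational language with one binary symbol $<$ and three unary symbols, and let $\mathrm{Mod}(L_1)=2^{\omega^2}\times2^{\omega}\times2^{\omega}\times2^{\omega}$, with the product topology, be the Polish space of $L_1$-structures with underlying set $\omega$. For $S_1,S_2\in\mathrm{Mod}(L_1)$ write $S_1\cong_{L_1}S_2$ if some bijection $\omega\to\omega$ preserves and reflects all four relations. For equivalence relations $E,F$ on Polish spaces $X,Y$, a Borel reduction from $(X,E)$ to $(Y,F)$ is a Borel function $f\colon X\to Y$ with $x_1\,E\,x_2\iff f(x_1)\,F\,f(x_2)$ for all $x_1,x_2\in X$; $(X,E)\le_B(Y,F)$ means that one exists. For $*\in\mathcal T$ let $\mathcal I_M^*$ be the set of maximal nonempty open intervals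 consisting of idempotent elements ($q*q=q$). Let $\mathcal I_P^*$ (respectively $\mathcal I_{\text{Ł}}^*$) be the set of maximal nonempty open intervals $(x,y)$ consisting of non-idempotent elements such that the restriction of $*$ to $[x,y]$ is a continuous t-norm isomorphic to the product t-norm $pq$ (respectively to the Łukasiewicz t-norm $\max\{0,p+q-1\}$) on $[0,1]$. Put $\varUpsilon(*)=\mathcal I_P^*\cup\mathcal I_{\text{Ł}}^*\cup\mathcal I_M^*$, ordered by $(x,y)\prec(x',y')\iff y\le x'$. Given an enumeration $\{q_n\}_{n\in\omega}$ of $\mathbb Q\cap[0,1]$ without repetition, let $n^*_{xy}$ be the least $n$ with $q_n\in(x,y)$ if $(x,y)\in\mathcal I_P^*\cup\mathcal I_{\text{Ł}}^*$, and the least $n$ with $q_n\in[x,y]$ if $(x,y)\in\mathcal I_M^*$. Let $S_*\in\mathrm{Mod}(L_1)$ be the structure in which $m<^{S_*}n$ if and only if $m=n^*_{xy}$ and $n=n^*_{x'y'}$ for some $(x,y)\prec(x',y')$ in $\varUpsilon(*)$, and $R_i^{S_*}=\{n^*_{xy}\mid(x,y)\in\mathcal I_i^*\}$ for $i\in\{P,\text{Ł},M\}$.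 **Proposition.** $(\mathcal T,\cong_t)\le_B(\mathrm{Mod}(L_1),\cong_{L_1})$. Moreover, for every enumeration $\{q_n\}_{n\in\omega}$ of $\mathbb Q\cap[0,1]$ without repetition, the map $*\mapsto S_*$ is a Borel reduction from $(\mathcal T,\cong_t)$ to $(\mathrm{Mod}(L_1),\cong_{L_1})$. -/

import Mathlib

/-! ### Borel reducibility of equivalence relations on Polish spaces -/

/-- `f` is a Borel reduction from `(X, E)` to `(Y, F)`: it is Borel measurable (for the Borel
σ-algebras of the topologies) and `x₁ E x₂ ↔ f x₁ F f x₂`. -/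
structure IsBorelReduction {X Y : Type*} [TopologicalSpace X] [PolishSpace X]
    [TopologicalSpace Y] [PolishSpace Y] (E : Setoid X) (F : Setoid Y) (f : X → Y) : Prop where
  borel_map : @Measurable X Y (borel X) (borel Y) f
  reduction : ∀ x₁ x₂ : X, E x₁ x₂ ↔ F (f x₁) (f x₂)

/-- `(X, E) ≤_B (Y, F)`. -/
def BorelReducible {X Y : Type*} [TopologicalSpace X] [PolishSpace X]
    [TopologicalSpace Y] [PolishSpace Y] (E : Setoid X) (F : Setoid Y) : Prop :=
  ∃ f : X → Y, IsBorelReduction E F f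

/-! ### Continuous t-norms -/

/-- The continuous map `f`, read as the operation `p * q = f (p, q)` on `[a, b]`, makes
`([a, b], *, b)` a commutative monoid and is monotone in both arguments. -/
structure IsTNorm {a b : ℝ} (f : C(Set.Icc a b × Set.Icc a b, Set.Icc a b)) : Prop where
  comm : ∀ p q, f (p, q) = f (q, p)
  assoc : ∀ p q r, f (f (p, q), r) = f (p, f (q, r))
  unit_left : ∀ e p : Set.Icc a b, (e : ℝ) = b → f (e, p) = p
  mono : ∀ p p' q q', p ≤ p' → q ≤ q' → f (p, q) ≤ f (p', q')

/-- Continuous t-norms on `[a, b]`. As a subtype of the space of continuous maps it carries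
the sup metric (whose topology is the compact-open topology). For `a = 0`, `b = 1` this is `𝒯`. -/
abbrev ContTNorm (a b : ℝ) : Type :=
  {f : C(Set.Icc a b × Set.Icc a b, Set.Icc a b) // IsTNorm f}

namespace ContTNorm

theorem isClosed_isTNorm (a b : ℝ) :
    IsClosed {f : C(Set.Icc a b × Set.Icc a b, Set.Icc a b) | IsTNorm f} := by
  have h : {f : C(Set.Icc a b × Set.Icc a b, Set.Icc a b) | IsTNorm f} =
      {f | ∀ p q, f (p, q) = f (q, p)} ∩ {f | ∀ p q r, f (f (p, q), r) = f (p, f (q, r))} ∩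
      {f | ∀ e p : Set.Icc a b, (e : ℝ) = b → f (e, p) = p} ∩
      {f | ∀ p p' q q', p ≤ p' → q ≤ q' → f (p, q) ≤ f (p', q')} := by
    ext f
    exact ⟨fun h => ⟨⟨⟨h.1, h.2⟩, h.3⟩, h.4⟩, fun h => ⟨h.1.1.1, h.1.1.2, h.1.2, h.2⟩⟩
  rw [h]
  refine ((IsClosed.inter ?_ ?_).inter ?_).inter ?_
  · simp only [Set.ofPred_forall]
    exact isClosed_iInter fun p => isClosed_iInter fun q =>
      isClosed_eq (by fun_prop) (by fun_prop)
  · simp only [Set.ofPred_forall]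
    refine isClosed_iInter fun p => isClosed_iInter fun q => isClosed_iInter fun r =>
      isClosed_eq ?_ ?_
    · exact continuous_eval.comp (continuous_id.prodMk
        ((continuous_eval_const (p, q)).prodMk continuous_const))
    · exact continuous_eval.comp (continuous_id.prodMk
        (continuous_const.prodMk (continuous_eval_const (q, r))))
  · simp only [Set.ofPred_forall]
    exact isClosed_iInter fun e => isClosed_iInter fun p => isClosed_iInter fun _ =>
      isClosed_eq (by fun_prop) continuous_const
  · simp only [Set.ofPred_forall]
    exact isClosed_iInter fun p => isClosed_iInter fun p' => isClosed_iInter fun q =>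
      isClosed_iInter fun q' => isClosed_iInter fun _ => isClosed_iInter fun _ =>
      isClosed_le (by fun_prop) (by fun_prop)

instance instPolishSpace (a b : ℝ) : PolishSpace (ContTNorm a b) :=
  (isClosed_isTNorm a b).polishSpace

/-- Isomorphism of continuous t-norms: an order isomorphism which is an isomorphism of monoids
(the units are the greatest elements, so they are preserved automatically). -/
def Iso {a₁ b₁ a₂ b₂ : ℝ} (T₁ : ContTNorm a₁ b₁) (T₂ : ContTNorm a₂ b₂) : Prop :=
  ∃ φ : Set.Icc a₁ b₁ ≃o Set.Icc a₂ b₂, ∀ p q, φ (T₁.1 (p, q)) = T₂.1 (φ p, φ q)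

/-- The equivalence relation `≅_t` on `𝒯`. -/
def isoSetoid : Setoid (ContTNorm 0 1) where
  r T₁ T₂ := Iso T₁ T₂
  iseqv :=
    { refl := fun _ => ⟨OrderIso.refl _, fun _ _ => rfl⟩
      symm := by
        rintro T₁ T₂ ⟨φ, h⟩
        refine ⟨φ.symm, fun p q => ?_⟩
        apply φ.injective
        simp [h]
      trans := by
        rintro T₁ T₂ T₃ ⟨φ, h⟩ ⟨ψ, k⟩
        exact ⟨φ.trans ψ, fun p q => by simp [h, k]⟩ }

/-- The product t-norm `p * q = pq` on `[0, 1]`. -/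
def product : ContTNorm 0 1 where
  val :=
    { toFun := fun x => ⟨(x.1 : ℝ) * x.2, mul_nonneg x.1.2.1 x.2.2.1,
        mul_le_one₀ x.1.2.2 x.2.2.1 x.2.2.2⟩
      continuous_toFun := by fun_prop }
  property :=
    { comm := fun p q => Subtype.ext (mul_comm (p : ℝ) q)
      assoc := fun p q r => Subtype.ext (mul_assoc (p : ℝ) q r)
      unit_left := fun e p he => Subtype.ext (by simp [he])
      mono := fun p p' q q' hp hq => mul_le_mul (α := ℝ) hp hq q.2.1 p'.2.1 }

/-- The Łukasiewicz t-norm `p * q = max 0 (p + q - 1)` on `[0, 1]`. -/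
def lukasiewicz : ContTNorm 0 1 where
  val :=
    { toFun := fun x => ⟨max 0 ((x.1 : ℝ) + x.2 - 1), le_max_left _ _,
        max_le zero_le_one (by linarith [x.1.2.2, x.2.2.2])⟩
      continuous_toFun := by fun_prop }
  property :=
    { comm := fun p q => Subtype.ext (by simp [add_comm])
      assoc := fun p q r => Subtype.ext (by
        have hp := p.2.2
        have hr := r.2.2
        change max 0 (max 0 ((p : ℝ) + q - 1) + r - 1) = max 0 ((p : ℝ) + max 0 ((q : ℝ) + r - 1) - 1)
        rcases max_cases 0 ((p : ℝ) + q - 1) with h | h <;>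
        rcases max_cases 0 ((q : ℝ) + r - 1) with k | k <;>
        rw [h.1, k.1] <;>
        first
          | (congr 1; ring1)
          | (rw [max_eq_left (by linarith), max_eq_left (by linarith)]))
      unit_left := fun e p he => Subtype.ext (by simp [he, p.2.1])
      mono := fun p p' q q' hp hq => by
        have hp' : (p : ℝ) ≤ p' := hp
        have hq' : (q : ℝ) ≤ q' := hq
        exact max_le_max (le_refl (0 : ℝ)) (by linarith) }

/-! ### The components of a continuous t-norm on `[0, 1]` -/

/-- The set of idempotent elements of `T`, as a set of reals. -/
def idem (T : ContTNorm 0 1) : Set ℝ :=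
  {x | ∃ q : Set.Icc (0 : ℝ) 1, (q : ℝ) = x ∧ T.1 (q, q) = q}

/-- The set of non-idempotent elements of `T`, as a set of reals. -/
def nonIdem (T : ContTNorm 0 1) : Set ℝ :=
  {x | ∃ q : Set.Icc (0 : ℝ) 1, (q : ℝ) = x ∧ T.1 (q, q) ≠ q}

/-- The maximal nonempty open intervals contained in `S`, each given by its pair of end points.
For open `S` these are the pairwise disjoint open intervals of which `S` is the union. -/
def maxIntervals (S : Set ℝ) : Set (ℝ × ℝ) :=
  {I | I.1 < I.2 ∧ Set.Ioo I.1 I.2 ⊆ S ∧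
    ∀ c d : ℝ, Set.Ioo I.1 I.2 ⊆ Set.Ioo c d → Set.Ioo c d ⊆ S → c = I.1 ∧ d = I.2}

/-- `T` restricts to a continuous t-norm on `[a, b]` that is isomorphic to `T₀`. -/
def RestrictIso (T : ContTNorm 0 1) (I : ℝ × ℝ) (T₀ : ContTNorm 0 1) : Prop :=
  ∃ T' : ContTNorm I.1 I.2,
    (∀ (p q : Set.Icc I.1 I.2) (p' q' : Set.Icc (0 : ℝ) 1), (p : ℝ) = p' → (q : ℝ) = q' →
      (T'.1 (p, q) : ℝ) = T.1 (p', q')) ∧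
    Iso T' T₀

/-- `𝓘_P`: components of the non-idempotent set on which `T` is of product type. -/
def compP (T : ContTNorm 0 1) : Set (ℝ × ℝ) :=
  {I | I ∈ maxIntervals T.nonIdem ∧ T.RestrictIso I product}

/-- `𝓘_Ł`: components of the non-idempotent set on which `T` is of Łukasiewicz type. -/
def compL (T : ContTNorm 0 1) : Set (ℝ × ℝ) :=
  {I | I ∈ maxIntervals T.nonIdem ∧ T.RestrictIso I lukasiewicz}

/-- `𝓘_M`: maximal nonempty open intervals of idempotent elements. -/
def compM (T : ContTNorm 0 1) : Set (ℝ × ℝ) := maxIntervals T.idem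

/-- All components, `Υ(T) = 𝓘_P ∪ 𝓘_Ł ∪ 𝓘_M`. -/
def comps (T : ContTNorm 0 1) : Set (ℝ × ℝ) := T.compP ∪ T.compL ∪ T.compM

open Classical in
/-- The code of a component, relative to an enumeration of the rationals of `[0, 1]`: the least
index of a rational in the open interval (for `𝓘_P`, `𝓘_Ł`) or in the closed one (for `𝓘_M`).
Only used for components; there the sets are nonempty, so `sInf` is a minimum. -/
noncomputable def code (q : ℕ ≃ Set.Icc (0 : ℚ) 1) (T : ContTNorm 0 1) (I : ℝ × ℝ) : ℕ :=
  if I ∈ T.compP ∪ T.compL then sInf {n | (((q n : ℚ)) : ℝ) ∈ Set.Ioo I.1 I.2}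
  else sInf {n | (((q n : ℚ)) : ℝ) ∈ Set.Icc I.1 I.2}

end ContTNorm

/-! ### Countable structures of a relational language -/

/-- `Mod(L) = ∏ i, 2 ^ (ω ^ nᵢ)`, the structures with universe `ℕ` of the relational language
with symbols `i : ι` of arity `ar i`. The topology is the product topology, `Bool` discrete. -/
abbrev ModSpace {ι : Type} (ar : ι → ℕ) : Type := (i : ι) → (Fin (ar i) → ℕ) → Bool

instance ModSpace.instPolishSpace {ι : Type} [Finite ι] (ar : ι → ℕ) :
    PolishSpace (ModSpace ar) := by
  have : Countable ι := Finite.to_countable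
  have : TopologicalSpace.IsCompletelyMetrizableSpace Bool :=
    TopologicalSpace.IsCompletelyMetrizableSpace.discrete
  have h : ∀ i, PolishSpace ((Fin (ar i) → ℕ) → Bool) := fun i => by
    have : Countable (Fin (ar i) → ℕ) := inferInstance
    have : TopologicalSpace.IsCompletelyMetrizableSpace ((Fin (ar i) → ℕ) → Bool) := inferInstance
    infer_instance
  infer_instance

/-- Isomorphism of structures with universe `ℕ`. -/
def ModSpace.isoSetoid {ι : Type} (ar : ι → ℕ) : Setoid (ModSpace ar) where
  r S₁ S₂ := ∃ ξ : ℕ ≃ ℕ, ∀ (i : ι) (k : Fin (ar i) → ℕ),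
    S₁ i k = true ↔ S₂ i (fun j => ξ (k j)) = true
  iseqv :=
    { refl := fun _ => ⟨Equiv.refl _, fun _ _ => Iff.rfl⟩
      symm := by
        rintro S₁ S₂ ⟨ξ, h⟩
        exact ⟨ξ.symm, fun i k => by simp [h]⟩
      trans := by
        rintro S₁ S₂ S₃ ⟨ξ, h⟩ ⟨η, g⟩
        exact ⟨ξ.trans η, fun i k => (h i k).trans (g i _)⟩ }

/-- The relation symbols `<`, `R_P`, `R_Ł`, `R_M` of `L₁`. -/
inductive L1Symbol : Type
  | lt
  | P
  | L
  | M

/-- `<` is binary, the other three symbols are unary. -/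
def L1Symbol.arity : L1Symbol → ℕ
  | lt => 2
  | P => 1
  | L => 1
  | M => 1

instance L1Symbol.instFinite : Finite L1Symbol :=
  Finite.of_surjective (fun n : Fin 4 => (![lt, P, L, M] : Fin 4 → L1Symbol) n) (by
    rintro ⟨⟩
    exacts [⟨0, rfl⟩, ⟨1, rfl⟩, ⟨2, rfl⟩, ⟨3, rfl⟩])

/-- `Mod(L₁)`. -/
abbrev ModL1 : Type := ModSpace L1Symbol.arity

open Classical in
/-- The `L₁`-structure coding a continuous t-norm: the codes of the components, ordered as the
components are on the line and labelled by their type; a natural number that is not a code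
is in no relation. -/
noncomputable def ContTNorm.toModL1 (q : ℕ ≃ Set.Icc (0 : ℚ) 1) (T : ContTNorm 0 1) : ModL1
  | .lt, k => decide (∃ I ∈ T.comps, ∃ J ∈ T.comps,
      T.code q I = k (0 : Fin 2) ∧ T.code q J = k (1 : Fin 2) ∧ I.2 ≤ J.1)
  | .P, k => decide (∃ I ∈ T.compP, T.code q I = k (0 : Fin 1))
  | .L, k => decide (∃ I ∈ T.compL, T.code q I = k (0 : Fin 1))
  | .M, k => decide (∃ I ∈ T.compM, T.code q I = k (0 : Fin 1))

/-! A continuous t-norm is an ordinal sum. Its idempotents form a closed set. On each component of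
the complement the operation has no interior idempotents, so it is a copy of the product or of the
Łukasiewicz t-norm (`iso_product_or_lukasiewicz`). Two points separated by an idempotent multiply to
their minimum (`op_of_idem_between`). Hence the components, their order and their types determine
the t-norm up to isomorphism.

The classification runs through a one-parameter semigroup. Iterated square roots of an interior
point converge to the unit, and they generate a continuous decreasing `g` with `g (s + t) = g s * g
t`. If `g` never reaches the bottom, a logarithmic change of variable gives the product; if it does,
an affine one gives Łukasiewicz.

An isomorphism of t-norms carries components to components and so induces an isomorphism of
structures; the non-codes are matched arbitrarily, which is possible because there are always
infinitely many (`infinite_compl_codes`). Conversely, an isomorphism of structures matches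
components of equal type in the same order. Isomorphisms chosen on the components glue to an
increasing map on a dense set, which extends to an order automorphism; the multiplicative identity
passes to the closure (`iso_of_components`).

For Borel measurability, being a code is rewritten as a countable Boolean combination of closed
conditions on the t-norm. The type of a component is read off from iterated squares of one of its
points (`mem_compP_iff`), and an existential quantifier over a compact interval of idempotents keeps
a set closed (`isClosed_exists_idem`). -/

open Set Filter Topology

/-! ### One-parameter semigroups in ordered topological monoids without interior idempotents -/

section Generator

theorem pow_two_pow_sqrt_seq {M : Type*} [CommMonoid M] {v : ℕ → M}
    (hv : ∀ k, v (k + 1) * v (k + 1) = v k) (k j n : ℕ) :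
    v (k + j) ^ (2 ^ j * n) = v k ^ n := by
  induction j with
  | zero => simp
  | succ j ih =>
    rw [← ih, ← hv (k + j), ← pow_two, ← pow_mul]
    congr 1
    ring

variable {α : Type*} [ConditionallyCompleteLinearOrder α] [TopologicalSpace α] [OrderTopology α]
  [CommMonoid α] [IsOrderedMonoid α] [ContinuousMul α] [OrderBot α]

/-- The one-parameter semigroup through a sequence of iterated square roots. -/
theorem exists_semigroup_of_sqrt_seq (h1 : ∀ x : α, x ≤ 1) {v : ℕ → α}
    (hv : ∀ k, v (k + 1) * v (k + 1) = v k) (hlim : Tendsto v atTop (𝓝 1)) :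
    ∃ g : ℝ → α, Antitone g ∧ (∀ t ≤ 0, g t = 1) ∧
      (∀ s t, 0 ≤ s → 0 ≤ t → g (s + t) = g s * g t) ∧ ∀ k : ℕ, g ((2 ^ k)⁻¹) = v k := by
  have hanti : ∀ x : α, Antitone fun n : ℕ => x ^ n := fun x m n hmn => by
    obtain ⟨d, rfl⟩ := Nat.exists_eq_add_of_le hmn
    simp only [pow_add]
    exact mul_le_of_le_one_right' (h1 _)
  -- Since `v k` plays the role of `g (2⁻ᵏ)`, this is the value at the dyadic number just below `t`;
  -- refining the grid only decreases it. The natural floor is `0` for `t ≤ 0`, which makes `g`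
  -- equal to `1` there.
  let w : ℝ → ℕ → α := fun t k => v k ^ ⌊2 ^ k * t⌋₊
  have hw : ∀ t, Antitone (w t) := fun t => antitone_nat_of_succ_le fun k => by
    have := pow_two_pow_sqrt_seq hv k 1 ⌊2 ^ k * t⌋₊
    simp only [w]
    rw [← this]
    apply hanti
    rcases le_or_gt t 0 with ht | ht
    · rw [Nat.floor_of_nonpos (mul_nonpos_of_nonneg_of_nonpos (by positivity) ht)]
      simp
    · apply Nat.le_floor
      have := Nat.floor_le (show 0 ≤ (2 : ℝ) ^ k * t by positivity)
      push_cast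
      rw [pow_succ]
      linarith
  let g : ℝ → α := fun t => ⨅ k, w t k
  have hg : ∀ t, Tendsto (w t) atTop (𝓝 (g t)) := fun t =>
    tendsto_atTop_ciInf (hw t) ⟨⊥, by rintro _ ⟨k, rfl⟩; exact bot_le⟩
  refine ⟨g, fun s t hst => ?_, fun t ht => ?_, fun s t hs ht => ?_, fun k => ?_⟩
  · refine le_of_tendsto_of_tendsto' (hg t) (hg s) fun k => ?_
    exact hanti _ (Nat.floor_le_floor (by gcongr))
  · refine tendsto_nhds_unique (hg t) (tendsto_const_nhds.congr fun k => ?_)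
    simp only [w]
    rw [Nat.floor_of_nonpos (mul_nonpos_of_nonneg_of_nonpos (by positivity) ht), pow_zero]
  -- The floor of a sum exceeds the sum of the floors by at most one. The possible extra factor `v
  -- k` tends to `1`, so a squeeze gives the semigroup law.
  · have h2 := (hg s).mul (hg t)
    have h3 := h2.mul hlim
    rw [mul_one] at h3
    refine (tendsto_of_tendsto_of_tendsto_of_le_of_le h3 h2 (fun k => ?_) fun k => ?_
      : Tendsto (w (s + t)) _ _) |> tendsto_nhds_unique (hg (s + t))
    · simp only [w]
      rw [← pow_add, ← pow_succ]
      apply hanti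
      rw [mul_add]
      have h4 : 2 ^ k * s < ⌊2 ^ k * s⌋₊ + 1 := Nat.lt_floor_add_one _
      have h5 : 2 ^ k * t < ⌊2 ^ k * t⌋₊ + 1 := Nat.lt_floor_add_one _
      have : ⌊2 ^ k * s + 2 ^ k * t⌋₊ < ⌊2 ^ k * s⌋₊ + ⌊2 ^ k * t⌋₊ + 2 := by
        rw [Nat.floor_lt (by positivity)]
        push_cast
        linarith
      omega
    · simp only [w]
      rw [← pow_add, mul_add]
      refine hanti _ (Nat.le_floor ?_)
      push_cast
      exact add_le_add (Nat.floor_le (by positivity)) (Nat.floor_le (by positivity))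
  · refine tendsto_nhds_unique (hg _) (tendsto_const_nhds.congr' ?_)
    filter_upwards [eventually_ge_atTop k] with m hm
    obtain ⟨j, rfl⟩ := Nat.exists_eq_add_of_le hm
    simp only [w]
    have h6 : (2 : ℝ) ^ (k + j) * (2 ^ k)⁻¹ = ((2 ^ j : ℕ) : ℝ) := by
      push_cast
      rw [pow_add]
      field_simp
    rw [h6, Nat.floor_natCast]
    have := pow_two_pow_sqrt_seq hv k j 1
    rw [mul_one, pow_one] at this
    exact this.symm

variable [DenselyOrdered α]

theorem exists_mul_self_eq (h1 : ∀ x : α, x ≤ 1) (u : α) : ∃ v : α, v * v = u := by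
  have hc : Continuous fun v : α => v * v := by fun_prop
  have := mem_range_of_exists_le_of_exists_ge (c := u) hc
    ⟨⊥, (mul_le_of_le_one_right' (h1 ⊥)).trans bot_le⟩ ⟨1, by simpa using h1 u⟩
  exact this

/-- Successive square roots increase, and their supremum is an idempotent above `u`. As it is not
`⊥`, it must be `1`. -/
theorem exists_sqrt_seq (h1 : ∀ x : α, x ≤ 1) (h : ∀ x : α, x * x = x → x = ⊥ ∨ x = 1)
    {u : α} (hu : u ≠ ⊥) :
    ∃ v : ℕ → α, v 0 = u ∧ (∀ k, v (k + 1) * v (k + 1) = v k) ∧ Tendsto v atTop (𝓝 1) := by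
  choose r hr using exists_mul_self_eq h1
  let v : ℕ → α := fun k => r^[k] u
  have hv : ∀ k, v (k + 1) * v (k + 1) = v k := fun k => by
    simp only [v, Function.iterate_succ_apply', hr]
  have hmono : Monotone v := monotone_nat_of_le_succ fun k => by
    rw [← hv k]; exact mul_le_of_le_one_right' (h1 _)
  have hbdd : BddAbove (range v) := ⟨1, by rintro _ ⟨k, rfl⟩; exact h1 _⟩
  have hlim := tendsto_atTop_ciSup hmono hbdd
  set l := ⨆ k, v k
  have hl : l * l = l := by
    have h2 : Tendsto (fun k => v (k + 1) * v (k + 1)) atTop (𝓝 (l * l)) :=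
      ((tendsto_add_atTop_iff_nat 1).2 hlim).mul ((tendsto_add_atTop_iff_nat 1).2 hlim)
    simp only [hv] at h2
    exact tendsto_nhds_unique h2 hlim
  have hul : u ≤ l := le_ciSup hbdd 0
  have : l = 1 := (h l hl).resolve_left fun hb => hu (le_bot_iff.1 (hb ▸ hul))
  exact ⟨v, rfl, hv, this ▸ hlim⟩

/-- Right continuity at `0` comes from the roots tending to `1`, and the semigroup law carries it to
all positive times. The limit at infinity is an idempotent below `u < 1`, hence `⊥`, so by the
intermediate value theorem every other element is reached. -/
theorem exists_generator (h1 : ∀ x : α, x ≤ 1) (hbot : (⊥ : α) ≠ 1)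
    (h : ∀ x : α, x * x = x → x = ⊥ ∨ x = 1) :
    ∃ g : ℝ → α, Antitone g ∧ Continuous g ∧ g 0 = 1 ∧
      (∀ s t, 0 ≤ s → 0 ≤ t → g (s + t) = g s * g t) ∧
      (∀ p, p ≠ ⊥ → ∃ t, 0 ≤ t ∧ g t = p) ∧
      ∀ s t, 0 ≤ s → s < t → g s = g t → g s = ⊥ := by
  obtain ⟨u, hu, hu1⟩ := exists_between (lt_of_le_of_ne bot_le hbot)
  obtain ⟨v, hv0, hv, hlim⟩ := exists_sqrt_seq h1 h hu.ne'
  obtain ⟨g, hanti, hneg, hadd, hgv⟩ := exists_semigroup_of_sqrt_seq h1 hv hlim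
  have hg0 : g 0 = 1 := hneg 0 le_rfl
  have hg1 : g 1 = u := by simpa [hv0] using hgv 0
  have hbot_mul : ∀ x : α, x * ⊥ = ⊥ := fun x => le_bot_iff.1 (mul_le_of_le_one_left' (h1 x))
  have hright0 : Tendsto g (𝓝[>] 0) (𝓝 1) := by
    refine tendsto_order.2 ⟨fun a ha => ?_, fun a ha => Eventually.of_forall fun t =>
      (h1 _).trans_lt ha⟩
    obtain ⟨k, hk⟩ := (hlim.eventually (lt_mem_nhds ha)).exists
    have : (0 : ℝ) < (2 ^ k)⁻¹ := by positivity
    filter_upwards [Ioo_mem_nhdsGT this] with t ht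
    exact hk.trans_le (hgv k ▸ hanti ht.2.le)
  have hshift : ∀ t : ℝ, Tendsto (fun s => s - t) (𝓝[>] t) (𝓝[>] 0) := fun t => by
    refine tendsto_nhdsWithin_iff.2 ⟨?_, ?_⟩
    · have : Tendsto (fun s => s - t) (𝓝 t) (𝓝 (t - t)) := by
        exact (continuous_id.sub continuous_const).tendsto t
      rw [sub_self] at this
      exact this.mono_left nhdsWithin_le_nhds
    · filter_upwards [self_mem_nhdsWithin] with s hs
      exact sub_pos.2 (mem_Ioi.1 hs)
  have hshift' : ∀ t : ℝ, Tendsto (fun s => t - s) (𝓝[<] t) (𝓝[>] 0) := fun t => by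
    refine tendsto_nhdsWithin_iff.2 ⟨?_, ?_⟩
    · have : Tendsto (fun s => t - s) (𝓝 t) (𝓝 (t - t)) := by
        exact (continuous_const.sub continuous_id).tendsto t
      rw [sub_self] at this
      exact this.mono_left nhdsWithin_le_nhds
    · filter_upwards [self_mem_nhdsWithin] with s hs
      exact sub_pos.2 (mem_Iio.1 hs)
  have hcont : Continuous g := by
    refine continuous_iff_continuousAt.2 fun t => ?_
    rcases lt_or_ge t 0 with ht | ht
    · refine (continuousAt_const (y := (1 : α))).congr ?_
      filter_upwards [gt_mem_nhds ht] with s hs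
      exact (hneg s hs.le).symm
    refine continuousAt_iff_continuous_left'_right'.2 ⟨?_, ?_⟩
    · rcases ht.eq_or_lt with rfl | ht
      · refine (tendsto_const_nhds (x := g 0)).congr' ?_
        filter_upwards [self_mem_nhdsWithin] with s hs
        rw [hg0, hneg s (le_of_lt hs)]
      -- The left limit exists by monotonicity; letting `s` increase to `t` in `g s * g (t - s) = g
      -- t` identifies it with `g t`.
      · have hl := hanti.tendsto_nhdsLT t
        have h2 := hl.mul (hright0.comp (hshift' t))
        have h3 : Tendsto (fun s => g s * (g ∘ fun s => t - s) s) (𝓝[<] t) (𝓝 (g t)) := by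
          refine tendsto_const_nhds.congr' ?_
          filter_upwards [Ioo_mem_nhdsLT ht] with s hs
          rw [Function.comp_apply, ← hadd s (t - s) hs.1.le (by linarith [hs.2])]
          congr 1
          ring
        have h4 := tendsto_nhds_unique h2 h3
        rw [mul_one] at h4
        rw [h4] at hl
        exact hl
    · have h2 := ((tendsto_const_nhds (x := g t)).mul (hright0.comp (hshift t)))
      rw [mul_one] at h2
      refine h2.congr' ?_
      filter_upwards [self_mem_nhdsWithin] with s hs
      rw [Function.comp_apply, ← hadd t (s - t) ht (by linarith [show t < s from hs])]
      congr 1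
      ring
  have hinf : Tendsto g atTop (𝓝 ⊥) := by
    have hl := tendsto_atTop_ciInf hanti ⟨⊥, by rintro _ ⟨k, rfl⟩; exact bot_le⟩
    set l := ⨅ t, g t
    have hle : l ≤ u := hg1 ▸ hanti.le_of_tendsto hl 1
    have hl2 : l * l = l := by
      have h2 : Tendsto (fun t : ℝ => g (t + t)) atTop (𝓝 l) :=
        hl.comp (tendsto_id.atTop_add_atTop tendsto_id)
      refine tendsto_nhds_unique (hl.mul hl) (h2.congr' ?_)
      filter_upwards [eventually_ge_atTop 0] with t ht
      exact hadd t t ht ht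
    have : l = ⊥ := (h l hl2).resolve_right fun h => (hle.trans_lt hu1).ne h
    exact this ▸ hl
  refine ⟨g, hanti, hcont, hg0, hadd, fun p hp => ?_, fun s t hs hst heq => ?_⟩
  · obtain ⟨t₁, ht₁⟩ := (hinf.eventually (gt_mem_nhds (bot_lt_iff_ne_bot.2 hp))).exists
    obtain ⟨t, rfl⟩ := mem_range_of_exists_le_of_exists_ge hcont ⟨t₁, ht₁.le⟩ ⟨0, hg0 ▸ h1 p⟩
    rcases le_total 0 t with ht | ht
    · exact ⟨t, ht, rfl⟩
    · exact ⟨0, le_rfl, by rw [hg0, hneg t ht]⟩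
  -- A repeated value absorbs `g (t - s)`, so `g` is constant along the progression `s + n (t - s)`,
  -- and the limit at infinity forces this constant to be `⊥`.
  · have hmul : g s * g (t - s) = g s := by
      rw [← hadd s (t - s) hs (by linarith), heq]
      congr 1
      ring
    have hn : ∀ n : ℕ, g (s + n * (t - s)) = g s := fun n => by
      induction n with
      | zero => simp
      | succ n ih =>
        have : s + ((n + 1 : ℕ) : ℝ) * (t - s) = (s + n * (t - s)) + (t - s) := by
          push_cast; ring
        have h0 : 0 ≤ t - s := by linarith
        rw [this, hadd _ _ (by positivity) h0, ih, hmul]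
    have hlim2 : Tendsto (fun n : ℕ => s + n * (t - s)) atTop atTop :=
      tendsto_atTop_add_const_left _ _
        (tendsto_natCast_atTop_atTop.atTop_mul_const (by linarith))
    have h2 := hinf.comp hlim2
    exact tendsto_nhds_unique (tendsto_const_nhds.congr fun n => (hn n).symm) h2

end Generator

/-! ### Continuous t-norms without interior idempotents -/

namespace ContTNorm

theorem exists_generator {a b : ℝ} (hab : a < b) (T : ContTNorm a b)
    (h : ∀ p, T.1 (p, p) = p → (p : ℝ) = a ∨ (p : ℝ) = b) :
    ∃ g : ℝ → Icc a b, Antitone g ∧ Continuous g ∧ (g 0 : ℝ) = b ∧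
      (∀ s t, 0 ≤ s → 0 ≤ t → g (s + t) = T.1 (g s, g t)) ∧
      (∀ p : Icc a b, (p : ℝ) ≠ a → ∃ t, 0 ≤ t ∧ g t = p) ∧
      ∀ s t, 0 ≤ s → s < t → g s = g t → (g s : ℝ) = a := by
  have : Fact (a ≤ b) := ⟨hab.le⟩
  let _ : CommMonoid (Icc a b) :=
    { mul := fun p q => T.1 (p, q)
      one := ⟨b, right_mem_Icc.2 hab.le⟩
      mul_assoc := T.2.assoc
      mul_comm := T.2.comm
      one_mul := fun p => T.2.unit_left _ _ rfl
      mul_one := fun p => (T.2.comm _ _).trans (T.2.unit_left _ _ rfl) }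
  have : IsOrderedMonoid (Icc a b) :=
    { mul_le_mul_left := fun p q hpq r => T.2.mono _ _ _ _ hpq le_rfl }
  have : ContinuousMul (Icc a b) := ⟨T.1.continuous⟩
  have hbot : ((⊥ : Icc a b) : ℝ) = a := rfl
  have h1 : ∀ x : Icc a b, x ≤ 1 := fun x => x.2.2
  obtain ⟨g, hg⟩ := _root_.exists_generator (α := Icc a b) h1
    (fun h => hab.ne (congrArg Subtype.val h)) (fun x hx => by
      rcases h x hx with h | h
      · exact Or.inl (Subtype.ext h)
      · exact Or.inr (Subtype.ext h))
  refine ⟨g, hg.1, hg.2.1, congrArg Subtype.val hg.2.2.1, hg.2.2.2.1,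
    fun p hp => hg.2.2.2.2.1 p fun h => hp (congrArg Subtype.val h),
    fun s t hs hst h => congrArg Subtype.val (hg.2.2.2.2.2 s t hs hst h)⟩

theorem left_absorb {a b : ℝ} (T : ContTNorm a b) (e p : Icc a b) (he : (e : ℝ) = a) :
    T.1 (e, p) = e := by
  have hb : b ∈ Icc a b := right_mem_Icc.2 (p.2.1.trans p.2.2)
  refine le_antisymm ?_ (Subtype.coe_le_coe.1 (he.le.trans (T.1 (e, p)).2.1))
  calc T.1 (e, p) ≤ T.1 (e, ⟨b, hb⟩) := T.2.mono _ _ _ _ le_rfl (Subtype.coe_le_coe.1 p.2.2)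
    _ = e := by rw [T.2.comm]; exact T.2.unit_left _ _ rfl

/-- A strictly monotone multiplicative surjection from the unit interval gives an isomorphism. -/
theorem iso_of_strictMono {a b : ℝ} {T : ContTNorm a b} {T₀ : ContTNorm 0 1}
    (ψ : Icc (0 : ℝ) 1 → Icc a b) (hmono : StrictMono ψ) (hsurj : Function.Surjective ψ)
    (hmul : ∀ p q, ψ (T₀.1 (p, q)) = T.1 (ψ p, ψ q)) : Iso T T₀ := by
  refine ⟨(hmono.orderIsoOfSurjective ψ hsurj).symm, fun p q => ?_⟩
  rw [OrderIso.symm_apply_eq]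
  change _ = ψ _
  rw [hmul]
  congr 2
  · exact ((hmono.orderIsoOfSurjective ψ hsurj).apply_symm_apply p).symm
  · exact ((hmono.orderIsoOfSurjective ψ hsurj).apply_symm_apply q).symm

theorem iso_product_of_generator {a b : ℝ} (hab : a < b) {T : ContTNorm a b} {g : ℝ → Icc a b}
    (hanti : Antitone g)
    (hadd : ∀ s t, 0 ≤ s → 0 ≤ t → g (s + t) = T.1 (g s, g t))
    (hsurj : ∀ p : Icc a b, (p : ℝ) ≠ a → ∃ t, 0 ≤ t ∧ g t = p)
    (hinj : ∀ s t, 0 ≤ s → s < t → g s = g t → (g s : ℝ) = a)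
    (hpos : ∀ t, 0 ≤ t → (g t : ℝ) ≠ a) : Iso T product := by
  classical
  have hlog : ∀ s : Icc (0 : ℝ) 1, 0 ≤ -Real.log s := fun s =>
    neg_nonneg.2 (Real.log_nonpos s.2.1 s.2.2)
  -- The point `0` needs its own clause: `Real.log 0 = 0` would send it to the top instead of the
  -- bottom.
  let ψ : Icc (0 : ℝ) 1 → Icc a b := fun s =>
    if (s : ℝ) = 0 then ⟨a, left_mem_Icc.2 hab.le⟩ else g (-Real.log s)
  have hψ0 : ∀ s : Icc (0 : ℝ) 1, (s : ℝ) = 0 → (ψ s : ℝ) = a := fun s hs =>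
    congrArg Subtype.val (if_pos hs)
  have hψ : ∀ s : Icc (0 : ℝ) 1, (s : ℝ) ≠ 0 → ψ s = g (-Real.log s) := fun s hs => if_neg hs
  refine iso_of_strictMono ψ (fun s t hst => ?_) (fun p => ?_) fun s t => ?_
  · have hst' : (s : ℝ) < t := hst
    have ht : (t : ℝ) ≠ 0 := (s.2.1.trans_lt hst').ne'
    rw [hψ t ht]
    by_cases hs : (s : ℝ) = 0
    · rw [← Subtype.coe_lt_coe, hψ0 s hs]
      exact lt_of_le_of_ne (g _).2.1 (hpos _ (hlog t)).symm
    · rw [hψ s hs]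
      have hlt : -Real.log t < -Real.log s :=
        neg_lt_neg (Real.log_lt_log (lt_of_le_of_ne s.2.1 (Ne.symm hs)) hst')
      refine lt_of_le_of_ne (hanti hlt.le) fun h => ?_
      exact hpos _ (hlog t) (hinj _ _ (hlog t) hlt h.symm)
  · by_cases hp : (p : ℝ) = a
    · exact ⟨⟨0, by simp⟩, Subtype.ext ((hψ0 _ rfl).trans hp.symm)⟩
    · obtain ⟨t, ht, rfl⟩ := hsurj p hp
      refine ⟨⟨Real.exp (-t), (Real.exp_pos _).le, Real.exp_le_one_iff.2 (by linarith)⟩, ?_⟩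
      rw [hψ _ (Real.exp_pos _).ne']
      simp
  · have hval : ((product.1 (s, t) : Icc (0 : ℝ) 1) : ℝ) = s * t := rfl
    by_cases hs : (s : ℝ) = 0
    · rw [left_absorb T _ _ (hψ0 s hs)]
      exact Subtype.ext ((hψ0 _ (by rw [hval, hs, zero_mul])).trans (hψ0 s hs).symm)
    by_cases ht : (t : ℝ) = 0
    · rw [T.2.comm, left_absorb T _ _ (hψ0 t ht)]
      exact Subtype.ext ((hψ0 _ (by rw [hval, ht, mul_zero])).trans (hψ0 t ht).symm)
    rw [hψ s hs, hψ t ht, hψ _ (by rw [hval]; exact mul_ne_zero hs ht), hval,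
      Real.log_mul hs ht, neg_add, hadd _ _ (hlog s) (hlog t)]

/-- Let `t₀` be the first time at which `g` reaches `a`. The change of variable `s ↦ t₀ (1 - s)`
turns addition of times into `s + t - 1`, and since `g` stays at `a` after `t₀`, sums beyond `t₀`
correspond to truncation at `0`. -/
theorem iso_lukasiewicz_of_generator {a b : ℝ} (hab : a < b) {T : ContTNorm a b} {g : ℝ → Icc a b}
    (hanti : Antitone g) (hcont : Continuous g) (hg0 : (g 0 : ℝ) = b)
    (hadd : ∀ s t, 0 ≤ s → 0 ≤ t → g (s + t) = T.1 (g s, g t))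
    (hsurj : ∀ p : Icc a b, (p : ℝ) ≠ a → ∃ t, 0 ≤ t ∧ g t = p)
    (hinj : ∀ s t, 0 ≤ s → s < t → g s = g t → (g s : ℝ) = a)
    {t₁ : ℝ} (ht₁ : 0 ≤ t₁) (hgt₁ : (g t₁ : ℝ) = a) : Iso T lukasiewicz := by
  set Z : Set ℝ := {t | 0 ≤ t ∧ (g t : ℝ) = a} with hZ
  have hZc : IsClosed Z :=
    isClosed_Ici.inter (isClosed_eq (continuous_subtype_val.comp hcont) continuous_const)
  have hZb : BddBelow Z := ⟨0, fun t ht => ht.1⟩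
  have hmem : sInf Z ∈ Z := hZc.csInf_mem ⟨t₁, ht₁, hgt₁⟩ hZb
  set t₀ := sInf Z with ht₀
  have hlt : ∀ t, 0 ≤ t → t < t₀ → (g t : ℝ) ≠ a := fun t h0 ht h =>
    (csInf_le hZb (show t ∈ Z from ⟨h0, h⟩)).not_gt ht
  have hge : ∀ t, t₀ ≤ t → (g t : ℝ) = a := fun t ht =>
    le_antisymm ((Subtype.coe_le_coe.2 (hanti ht)).trans hmem.2.le) (g t).2.1
  have hpos : 0 < t₀ := lt_of_le_of_ne hmem.1 fun h => by
    have := hmem.2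
    rw [← h, hg0] at this
    exact hab.ne' this
  let ψ : Icc (0 : ℝ) 1 → Icc a b := fun s => g (t₀ * (1 - s))
  have hnn : ∀ s : Icc (0 : ℝ) 1, 0 ≤ t₀ * (1 - (s : ℝ)) := fun s =>
    mul_nonneg hpos.le (by linarith [s.2.2])
  refine iso_of_strictMono ψ (fun s t hst => ?_) (fun p => ?_) fun s t => ?_
  · have hst' : (s : ℝ) < t := hst
    have hlt' : t₀ * (1 - (t : ℝ)) < t₀ * (1 - s) := by
      apply mul_lt_mul_of_pos_left _ hpos; linarith
    have : t₀ * (1 - (t : ℝ)) < t₀ := by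
      have : (0 : ℝ) < t := s.2.1.trans_lt hst'
      nlinarith
    refine lt_of_le_of_ne (hanti hlt'.le) fun h => ?_
    exact hlt _ (hnn t) this (hinj _ _ (hnn t) hlt' h.symm)
  · by_cases hp : (p : ℝ) = a
    · refine ⟨⟨0, by simp⟩, Subtype.ext ?_⟩
      simp only [ψ, sub_zero, mul_one]
      rw [hmem.2, hp]
    · obtain ⟨t, ht, rfl⟩ := hsurj p hp
      have htt : t < t₀ := not_le.1 fun h => hp (hge t h)
      refine ⟨⟨1 - t / t₀, by rw [sub_nonneg, div_le_one hpos]; exact htt.le,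
        by linarith [div_nonneg ht hpos.le]⟩, ?_⟩
      simp only [ψ]
      congr 1
      field_simp
      ring
  · have hval : ((lukasiewicz.1 (s, t) : Icc (0 : ℝ) 1) : ℝ) = max 0 ((s : ℝ) + t - 1) := rfl
    simp only [ψ]
    rw [hval, ← hadd _ _ (hnn s) (hnn t)]
    rcases le_total ((s : ℝ) + t - 1) 0 with h | h
    · rw [max_eq_left h]
      apply Subtype.ext
      rw [hge, hge]
      · nlinarith
      · linarith
    · rw [max_eq_right h]
      congr 1
      ring

/-- The classification of continuous t-norms without idempotents other than the end points. -/
theorem iso_product_or_lukasiewicz {a b : ℝ} (hab : a < b) (T : ContTNorm a b)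
    (h : ∀ p, T.1 (p, p) = p → (p : ℝ) = a ∨ (p : ℝ) = b) :
    Iso T product ∨ Iso T lukasiewicz := by
  obtain ⟨g, hanti, hcont, hg0, hadd, hsurj, hinj⟩ := exists_generator hab T h
  by_cases hpos : ∀ t, 0 ≤ t → (g t : ℝ) ≠ a
  · exact Or.inl (iso_product_of_generator hab hanti hadd hsurj hinj hpos)
  · push Not at hpos
    obtain ⟨t₁, ht₁, hgt₁⟩ := hpos
    exact Or.inr (iso_lukasiewicz_of_generator hab hanti hcont hg0 hadd hsurj hinj ht₁ hgt₁)

end ContTNorm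

/-! ### Order isomorphisms of intervals as restrictions of order automorphisms of the line -/

/-- Outside the interval `φ` is continued by translations; monotonicity uses that projection to an
interval is 1-Lipschitz. With automorphisms of the whole line, isomorphisms can be restricted to
subintervals and composed without subtypes. -/
theorem exists_orderIso_real_extend {a₁ b₁ a₂ b₂ : ℝ} (h₁ : a₁ ≤ b₁)
    (φ : Icc a₁ b₁ ≃o Icc a₂ b₂) : ∃ f : ℝ ≃o ℝ, ∀ p : Icc a₁ b₁, f p = φ p := by
  let f : ℝ → ℝ := fun x => φ (projIcc a₁ b₁ h₁ x) + (x - projIcc a₁ b₁ h₁ x)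
  have hf : ∀ p : Icc a₁ b₁, f p = φ p := fun p => by simp [f]
  have hmono : StrictMono f := fun x y hxy => by
    have h := monotone_projIcc h₁ hxy.le
    have hl : (projIcc a₁ b₁ h₁ y : ℝ) - projIcc a₁ b₁ h₁ x ≤ y - x := by
      have := abs_projIcc_sub_projIcc (c := y) (d := x) h₁
      rw [abs_of_pos (sub_pos.2 hxy)] at this
      exact (le_abs_self _).trans this
    simp only [f]
    rcases h.eq_or_lt with h | h
    · rw [h]; linarith
    · have : (φ (projIcc a₁ b₁ h₁ x) : ℝ) < φ (projIcc a₁ b₁ h₁ y) := φ.strictMono h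
      linarith
  have hcont : Continuous f := by
    have : Continuous φ := φ.continuous
    have h2 : Continuous (projIcc a₁ b₁ h₁) := continuous_projIcc
    fun_prop
  have htop : Tendsto f atTop atTop := by
    refine tendsto_atTop_mono (f := fun x => x + (a₂ - b₁)) (fun x => ?_)
      (tendsto_atTop_add_const_right _ _ tendsto_id)
    have := (φ (projIcc a₁ b₁ h₁ x)).2.1
    have := (projIcc a₁ b₁ h₁ x).2.2
    simp only [f]
    linarith
  have hbot : Tendsto f atBot atBot := by
    refine tendsto_atBot_mono (f := fun x => x + (b₂ - a₁)) (fun x => ?_)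
      (tendsto_atBot_add_const_right _ _ tendsto_id)
    have := (φ (projIcc a₁ b₁ h₁ x)).2.2
    have := (projIcc a₁ b₁ h₁ x).2.1
    simp only [f]
    linarith
  exact ⟨hmono.orderIsoOfSurjective f (hcont.surjective htop hbot), hf⟩

theorem OrderIso.apply_left_Icc {a₁ b₁ a₂ b₂ : ℝ} (h₁ : a₁ ≤ b₁)
    (φ : Icc a₁ b₁ ≃o Icc a₂ b₂) : (φ ⟨a₁, left_mem_Icc.2 h₁⟩ : ℝ) = a₂ := by
  have h₂ : a₂ ≤ b₂ := let p := φ ⟨a₁, left_mem_Icc.2 h₁⟩; p.2.1.trans p.2.2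
  refine le_antisymm ?_ (φ _).2.1
  have : φ ⟨a₁, left_mem_Icc.2 h₁⟩ ≤ ⟨a₂, left_mem_Icc.2 h₂⟩ := by
    rw [← φ.le_symm_apply]
    exact (φ.symm ⟨a₂, left_mem_Icc.2 h₂⟩).2.1
  exact this

theorem OrderIso.apply_right_Icc {a₁ b₁ a₂ b₂ : ℝ} (h₁ : a₁ ≤ b₁)
    (φ : Icc a₁ b₁ ≃o Icc a₂ b₂) : (φ ⟨b₁, right_mem_Icc.2 h₁⟩ : ℝ) = b₂ := by
  have h₂ : a₂ ≤ b₂ := let p := φ ⟨a₁, left_mem_Icc.2 h₁⟩; p.2.1.trans p.2.2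
  refine le_antisymm (φ _).2.2 ?_
  have : ⟨b₂, right_mem_Icc.2 h₂⟩ ≤ φ ⟨b₁, right_mem_Icc.2 h₁⟩ := by
    rw [← φ.symm_apply_le]
    exact (φ.symm ⟨b₂, right_mem_Icc.2 h₂⟩).2.2
  exact this

/-- The restriction to intervals of an order automorphism of the line. -/
def OrderIso.restrictIcc (f : ℝ ≃o ℝ) {a₁ b₁ a₂ b₂ : ℝ} (ha : f a₁ = a₂) (hb : f b₁ = b₂) :
    Icc a₁ b₁ ≃o Icc a₂ b₂ where
  toFun p := ⟨f p, ha ▸ f.monotone p.2.1, hb ▸ f.monotone p.2.2⟩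
  invFun p := ⟨f.symm p, f.le_symm_apply.2 (ha ▸ p.2.1), f.symm_apply_le.2 (hb ▸ p.2.2)⟩
  left_inv p := Subtype.ext (f.symm_apply_apply _)
  right_inv p := Subtype.ext (f.apply_symm_apply _)
  map_rel_iff' := f.le_iff_le

/-- `f` maps `[a₁, b₁]` onto `[a₂, b₂]` and carries the operation `S₁` to `S₂` there. -/
structure IsIntervalIso (S₁ S₂ : ℝ → ℝ → ℝ) (a₁ b₁ a₂ b₂ : ℝ) (f : ℝ ≃o ℝ) : Prop where
  map_left : f a₁ = a₂
  map_right : f b₁ = b₂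
  map_op : ∀ p ∈ Icc a₁ b₁, ∀ q ∈ Icc a₁ b₁, f (S₁ p q) = S₂ (f p) (f q)

namespace IsIntervalIso

variable {S₁ S₂ S₃ : ℝ → ℝ → ℝ} {a₁ b₁ a₂ b₂ a₃ b₃ : ℝ} {f g : ℝ ≃o ℝ}

theorem mem (h : IsIntervalIso S₁ S₂ a₁ b₁ a₂ b₂ f) {p : ℝ} (hp : p ∈ Icc a₁ b₁) :
    f p ∈ Icc a₂ b₂ :=
  ⟨h.map_left ▸ f.monotone hp.1, h.map_right ▸ f.monotone hp.2⟩

theorem symm (h : IsIntervalIso S₁ S₂ a₁ b₁ a₂ b₂ f) :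
    IsIntervalIso S₂ S₁ a₂ b₂ a₁ b₁ f.symm where
  map_left := by rw [← h.map_left, f.symm_apply_apply]
  map_right := by rw [← h.map_right, f.symm_apply_apply]
  map_op p hp q hq := by
    have hp' : f.symm p ∈ Icc a₁ b₁ :=
      ⟨f.le_symm_apply.2 (h.map_left ▸ hp.1), f.symm_apply_le.2 (h.map_right ▸ hp.2)⟩
    have hq' : f.symm q ∈ Icc a₁ b₁ :=
      ⟨f.le_symm_apply.2 (h.map_left ▸ hq.1), f.symm_apply_le.2 (h.map_right ▸ hq.2)⟩
    rw [OrderIso.symm_apply_eq, h.map_op _ hp' _ hq', f.apply_symm_apply, f.apply_symm_apply]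

theorem trans (h : IsIntervalIso S₁ S₂ a₁ b₁ a₂ b₂ f) (k : IsIntervalIso S₂ S₃ a₂ b₂ a₃ b₃ g) :
    IsIntervalIso S₁ S₃ a₁ b₁ a₃ b₃ (f.trans g) where
  map_left := by rw [OrderIso.trans_apply, h.map_left, k.map_left]
  map_right := by rw [OrderIso.trans_apply, h.map_right, k.map_right]
  map_op p hp q hq := by
    simp only [OrderIso.trans_apply]
    rw [h.map_op p hp q hq, k.map_op _ (h.mem hp) _ (h.mem hq)]

theorem mono (h : IsIntervalIso S₁ S₂ a₁ b₁ a₂ b₂ f) {a b : ℝ} (ha : a₁ ≤ a) (hb : b ≤ b₁) :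
    IsIntervalIso S₁ S₂ a b (f a) (f b) f :=
  ⟨rfl, rfl, fun p hp q hq =>
    h.map_op p ⟨ha.trans hp.1, hp.2.trans hb⟩ q ⟨ha.trans hq.1, hq.2.trans hb⟩⟩

end IsIntervalIso

/-! ### The operation of a continuous t-norm on the real line -/

namespace ContTNorm

variable (T : ContTNorm 0 1)

/-- The operation of `T`, extended to the line by projecting to the unit interval. -/
noncomputable def op (p q : ℝ) : ℝ :=
  T.1 (projIcc 0 1 zero_le_one p, projIcc 0 1 zero_le_one q)

theorem op_coe (p q : Icc (0 : ℝ) 1) : T.op p q = T.1 (p, q) := by simp [op]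

theorem continuous_op : Continuous fun x : ℝ × ℝ => T.op x.1 x.2 := by
  have h : Continuous (projIcc (0 : ℝ) 1 zero_le_one) := continuous_projIcc
  unfold op
  fun_prop

theorem op_mem (p q : ℝ) : T.op p q ∈ Icc (0 : ℝ) 1 := (T.1 _).2

theorem op_comm (p q : ℝ) : T.op p q = T.op q p := congrArg Subtype.val (T.2.comm _ _)

theorem op_assoc (p q r : ℝ) : T.op (T.op p q) r = T.op p (T.op q r) := by
  simp only [op, projIcc_val]
  exact congrArg Subtype.val (T.2.assoc _ _ _)

theorem op_mono {p p' q q' : ℝ} (hp : p ≤ p') (hq : q ≤ q') : T.op p q ≤ T.op p' q' :=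
  T.2.mono _ _ _ _ (monotone_projIcc _ hp) (monotone_projIcc _ hq)

theorem one_op {p : ℝ} (hp : p ∈ Icc (0 : ℝ) 1) : T.op 1 p = p := by
  have := T.2.unit_left ⟨1, by simp⟩ ⟨p, hp⟩ rfl
  rw [← Subtype.coe_inj, ← op_coe] at this
  exact this

theorem op_le_left {p : ℝ} (hp : p ∈ Icc (0 : ℝ) 1) {q : ℝ} (hq : q ≤ 1) : T.op p q ≤ p := by
  rw [op_comm]
  exact (T.op_mono hq le_rfl).trans (T.one_op hp).le

theorem mem_idem {x : ℝ} : x ∈ T.idem ↔ x ∈ Icc (0 : ℝ) 1 ∧ T.op x x = x := by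
  constructor
  · rintro ⟨q, rfl, hq⟩
    exact ⟨q.2, by rw [op_coe, hq]⟩
  · rintro ⟨hx, h⟩
    exact ⟨⟨x, hx⟩, rfl, Subtype.ext (by rw [← op_coe]; exact h)⟩

theorem mem_nonIdem {x : ℝ} : x ∈ T.nonIdem ↔ x ∈ Icc (0 : ℝ) 1 ∧ T.op x x ≠ x := by
  constructor
  · rintro ⟨q, rfl, hq⟩
    exact ⟨q.2, by rw [op_coe]; exact fun h => hq (Subtype.ext h)⟩
  · rintro ⟨hx, h⟩
    refine ⟨⟨x, hx⟩, rfl, fun h' => h ?_⟩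
    rw [← Subtype.coe_inj, ← op_coe] at h'
    exact h'

theorem mem_nonIdem_iff {x : ℝ} : x ∈ T.nonIdem ↔ x ∈ Icc (0 : ℝ) 1 ∧ x ∉ T.idem := by
  rw [mem_nonIdem, mem_idem]
  tauto

theorem zero_mem_idem : (0 : ℝ) ∈ T.idem :=
  T.mem_idem.2 ⟨by simp, le_antisymm (T.op_le_left (by simp) zero_le_one) (T.op_mem _ _).1⟩

theorem one_mem_idem : (1 : ℝ) ∈ T.idem := T.mem_idem.2 ⟨by simp, T.one_op (by simp)⟩

theorem isClosed_idem : IsClosed T.idem := by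
  have : T.idem = Icc 0 1 ∩ {x | T.op x x = x} := by
    ext x
    exact T.mem_idem
  rw [this]
  refine isClosed_Icc.inter (isClosed_eq ?_ continuous_id)
  exact T.continuous_op.comp (continuous_id.prodMk continuous_id)

theorem nonIdem_subset : T.nonIdem ⊆ Ioo 0 1 := fun x hx => by
  obtain ⟨hx, h⟩ := T.mem_nonIdem_iff.1 hx
  exact ⟨lt_of_le_of_ne hx.1 fun h0 => h (h0 ▸ T.zero_mem_idem),
    lt_of_le_of_ne hx.2 fun h0 => h (h0 ▸ T.one_mem_idem)⟩

theorem isOpen_nonIdem : IsOpen T.nonIdem := by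
  have : T.nonIdem = Ioo 0 1 ∩ T.idemᶜ := by
    ext x
    exact ⟨fun h => ⟨T.nonIdem_subset h, (T.mem_nonIdem_iff.1 h).2⟩,
      fun h => T.mem_nonIdem_iff.2 ⟨Ioo_subset_Icc_self h.1, h.2⟩⟩
  rw [this]
  exact isOpen_Ioo.inter T.isClosed_idem.isOpen_compl

/-- Continuity replaces divisibility: the intermediate value theorem writes `p = e * s`, and then `e
* p = (e * e) * s = p`. -/
theorem op_of_le_idem {e p : ℝ} (he : e ∈ T.idem) (hp : 0 ≤ p) (hpe : p ≤ e) : T.op e p = p := by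
  obtain ⟨heI, hee⟩ := T.mem_idem.1 he
  have hc : ContinuousOn (fun s => T.op e s) (Icc 0 1) :=
    (T.continuous_op.comp (continuous_const.prodMk continuous_id)).continuousOn
  have h0 : T.op e 0 ≤ p := by
    rw [op_comm]
    exact (T.op_le_left (by simp) heI.2).trans hp
  have h1 : p ≤ T.op e 1 := by rw [op_comm, T.one_op heI]; exact hpe
  obtain ⟨s, -, rfl⟩ := intermediate_value_Icc zero_le_one hc ⟨h0, h1⟩
  simp only
  rw [← op_assoc, hee]

/-- This is the ordinal sum structure: across an idempotent the operation is the minimum, whatever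
happens inside the components. -/
theorem op_of_idem_between {e p q : ℝ} (he : e ∈ T.idem) (hp : 0 ≤ p) (hpe : p ≤ e)
    (heq : e ≤ q) (hq : q ≤ 1) : T.op p q = p := by
  refine le_antisymm (T.op_le_left ⟨hp, hpe.trans (heq.trans hq)⟩ hq) ?_
  calc p = T.op p e := by rw [op_comm, T.op_of_le_idem he hp hpe]
    _ ≤ T.op p q := T.op_mono le_rfl heq

theorem op_mem_Icc {x y p q : ℝ} (hx : x ∈ T.idem) (hy : y ∈ T.idem) (hp : p ∈ Icc x y)
    (hq : q ∈ Icc x y) : T.op p q ∈ Icc x y :=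
  ⟨(T.mem_idem.1 hx).2 ▸ T.op_mono hp.1 hq.1,
    (T.op_mono hp.2 hq.2).trans (T.mem_idem.1 hy).2.le⟩

/-- The restriction of `T` to an interval with idempotent end points. -/
noncomputable def restrict {x y : ℝ} (hx : x ∈ T.idem) (hy : y ∈ T.idem) : ContTNorm x y where
  val :=
    { toFun := fun p => ⟨T.op p.1 p.2, T.op_mem_Icc hx hy p.1.2 p.2.2⟩
      continuous_toFun := by
        have := T.continuous_op.comp ((continuous_subtype_val.comp continuous_fst).prodMk
          (continuous_subtype_val.comp continuous_snd) :
            Continuous fun p : Icc x y × Icc x y => ((p.1 : ℝ), (p.2 : ℝ)))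
        exact this.subtype_mk _ }
  property :=
    { comm := fun p q => Subtype.ext (T.op_comm _ _)
      assoc := fun p q r => Subtype.ext (T.op_assoc _ _ _)
      unit_left := fun e p he => Subtype.ext (by
        change T.op e p = p
        rw [he]
        exact T.op_of_le_idem hy ((T.mem_idem.1 hx).1.1.trans p.2.1) p.2.2)
      mono := fun p p' q q' hp hq => T.op_mono hp hq }

theorem restrict_apply {x y : ℝ} (hx : x ∈ T.idem) (hy : y ∈ T.idem) (p q : Icc x y) :
    ((T.restrict hx hy).1 (p, q) : ℝ) = T.op p q := rfl

variable {T}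

theorem restrictIso_iff {I : ℝ × ℝ} {T₀ : ContTNorm 0 1} (h₁ : I.1 ∈ T.idem) (h₂ : I.2 ∈ T.idem)
    (hle : I.1 ≤ I.2) :
    T.RestrictIso I T₀ ↔ ∃ f, IsIntervalIso T.op T₀.op I.1 I.2 0 1 f := by
  have h01 := (T.mem_idem.1 h₁).1
  have h02 := (T.mem_idem.1 h₂).1
  constructor
  · rintro ⟨T', hT', φ, hφ⟩
    obtain ⟨f, hf⟩ := exists_orderIso_real_extend hle φ
    refine ⟨f, (hf ⟨_, left_mem_Icc.2 hle⟩).trans (φ.apply_left_Icc hle),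
      (hf ⟨_, right_mem_Icc.2 hle⟩).trans (φ.apply_right_Icc hle), fun p hp q hq => ?_⟩
    have := hT' ⟨p, hp⟩ ⟨q, hq⟩ ⟨p, h01.1.trans hp.1, hp.2.trans h02.2⟩
      ⟨q, h01.1.trans hq.1, hq.2.trans h02.2⟩ rfl rfl
    rw [← op_coe] at this
    change _ = T.op p q at this
    rw [← this, hf, hφ, ← op_coe, ← hf, ← hf]
  · rintro ⟨f, hf⟩
    refine ⟨T.restrict h₁ h₂, fun p q p' q' hp hq => ?_,
      f.restrictIcc hf.map_left hf.map_right, fun p q => Subtype.ext ?_⟩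
    · rw [restrict_apply, ← op_coe, hp, hq]
    · rw [← op_coe]
      exact hf.map_op p p.2 q q.2

theorem iso_iff {T₁ T₂ : ContTNorm 0 1} :
    Iso T₁ T₂ ↔ ∃ f, IsIntervalIso T₁.op T₂.op 0 1 0 1 f := by
  constructor
  · rintro ⟨φ, hφ⟩
    obtain ⟨f, hf⟩ := exists_orderIso_real_extend zero_le_one φ
    refine ⟨f, (hf ⟨_, by simp⟩).trans (φ.apply_left_Icc zero_le_one),
      (hf ⟨_, by simp⟩).trans (φ.apply_right_Icc zero_le_one), fun p hp q hq => ?_⟩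
    lift p to Icc (0 : ℝ) 1 using hp
    lift q to Icc (0 : ℝ) 1 using hq
    rw [op_coe, hf, hφ, ← op_coe, hf, hf]
  · rintro ⟨f, hf⟩
    refine ⟨f.restrictIcc hf.map_left hf.map_right, fun p q => Subtype.ext ?_⟩
    rw [← op_coe]
    change f (T₁.1 (p, q)) = T₂.op (f p) (f q)
    rw [← hf.map_op p p.2 q q.2, op_coe]

end ContTNorm

namespace ContTNorm

/-! ### Maximal open intervals -/

/-- The two ends can be pushed outwards independently, to an infimum and a supremum. No openness of
`S` is needed, so this serves both the open set of non-idempotents and the closed set of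
idempotents. -/
theorem exists_maxIntervals {S : Set ℝ} (hS : S ⊆ Icc 0 1) {c d : ℝ} (hcd : c < d)
    (h : Ioo c d ⊆ S) : ∃ I ∈ maxIntervals S, I.1 ≤ c ∧ d ≤ I.2 := by
  have hlow : ∀ x y, x < y → Ioo x y ⊆ S → 0 ≤ x ∧ y ≤ 1 := fun x y hxy hs => by
    have := closure_minimal (hs.trans hS) isClosed_Icc
    rw [closure_Ioo hxy.ne] at this
    exact ⟨(this (left_mem_Icc.2 hxy.le)).1, (this (right_mem_Icc.2 hxy.le)).2⟩
  let A : Set ℝ := {x | x ≤ c ∧ Ioo x d ⊆ S}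
  let B : Set ℝ := {y | d ≤ y ∧ Ioo c y ⊆ S}
  have hA : BddBelow A := ⟨0, fun x hx => (hlow x d (hx.1.trans_lt hcd) hx.2).1⟩
  have hB : BddAbove B := ⟨1, fun y hy => (hlow c y (hcd.trans_le hy.1) hy.2).2⟩
  have hcA : c ∈ A := ⟨le_rfl, h⟩
  have hdB : d ∈ B := ⟨le_rfl, h⟩
  have ha : sInf A ≤ c := csInf_le hA hcA
  have hb : d ≤ sSup B := le_csSup hB hdB
  refine ⟨(sInf A, sSup B), ⟨ha.trans_lt (hcd.trans_le hb), fun t ht => ?_, fun x y hxy hs => ?_⟩,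
    ha, hb⟩
  · rcases lt_or_ge t d with htd | htd
    · obtain ⟨x, hx, hxt⟩ := exists_lt_of_csInf_lt ⟨c, hcA⟩ ht.1
      exact hx.2 ⟨hxt, htd⟩
    · obtain ⟨y, hy, hty⟩ := exists_lt_of_lt_csSup ⟨d, hdB⟩ ht.2
      exact hy.2 ⟨hcd.trans_le htd, hty⟩
  · obtain ⟨hx, hy⟩ := (Ioo_subset_Ioo_iff (ha.trans_lt (hcd.trans_le hb))).1 hxy
    constructor
    · refine le_antisymm hx (csInf_le hA ⟨hx.trans ha, ?_⟩)
      exact (Ioo_subset_Ioo_right (hb.trans hy)).trans hs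
    · refine le_antisymm (le_csSup hB ⟨hb.trans hy, ?_⟩) hy
      exact (Ioo_subset_Ioo_left (hx.trans ha)).trans hs

theorem maxIntervals_eq_of_overlap {S : Set ℝ} {I J : ℝ × ℝ} (hI : I ∈ maxIntervals S)
    (hJ : J ∈ maxIntervals S) (h : max I.1 J.1 < min I.2 J.2) : I = J := by
  have hU : Ioo (min I.1 J.1) (max I.2 J.2) ⊆ S := by
    rw [← Ioo_union_Ioo' (lt_of_le_of_lt (le_max_right _ _) (h.trans_le (min_le_left _ _)))
      (lt_of_le_of_lt (le_max_left _ _) (h.trans_le (min_le_right _ _)))]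
    exact union_subset hI.2.1 hJ.2.1
  obtain ⟨h1, h2⟩ := hI.2.2 _ _ (Ioo_subset_Ioo (min_le_left _ _) (le_max_left _ _)) hU
  obtain ⟨h3, h4⟩ := hJ.2.2 _ _ (Ioo_subset_Ioo (min_le_right _ _) (le_max_right _ _)) hU
  exact Prod.ext (h1.symm.trans h3) (h2.symm.trans h4)

/-- A maximal open interval cannot be extended within the set. -/
theorem maxIntervals_endpoints_le {S : Set ℝ} {I : ℝ × ℝ} (hI : I ∈ maxIntervals S) {c d : ℝ}
    (hc : c ≤ I.1) (hd : I.2 ≤ d) (h : Ioo c d ⊆ S) : c = I.1 ∧ d = I.2 :=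
  hI.2.2 c d (Ioo_subset_Ioo hc hd) h

theorem left_notMem_of_mem_maxIntervals {S : Set ℝ} (hS : IsOpen S) {I : ℝ × ℝ}
    (hI : I ∈ maxIntervals S) : I.1 ∉ S := fun h => by
  obtain ⟨c, d, hcd, hs⟩ := mem_nhds_iff_exists_Ioo_subset.1 (hS.mem_nhds h)
  have hU : Ioo c I.2 ⊆ S := by
    refine fun t ht => ?_
    rcases lt_or_ge I.1 t with h1 | h1
    · exact hI.2.1 ⟨h1, ht.2⟩
    · exact hs ⟨ht.1, h1.trans_lt hcd.2⟩
  exact hcd.1.ne (maxIntervals_endpoints_le hI hcd.1.le le_rfl hU).1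

theorem right_notMem_of_mem_maxIntervals {S : Set ℝ} (hS : IsOpen S) {I : ℝ × ℝ}
    (hI : I ∈ maxIntervals S) : I.2 ∉ S := fun h => by
  obtain ⟨c, d, hcd, hs⟩ := mem_nhds_iff_exists_Ioo_subset.1 (hS.mem_nhds h)
  have hU : Ioo I.1 d ⊆ S := by
    refine fun t ht => ?_
    rcases lt_or_ge t I.2 with h1 | h1
    · exact hI.2.1 ⟨ht.1, h1⟩
    · exact hs ⟨hcd.1.trans_le h1, ht.2⟩
  exact hcd.2.ne' (maxIntervals_endpoints_le hI le_rfl hcd.2.le hU).2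

theorem Icc_subset_closure_of_mem_maxIntervals {S : Set ℝ} {I : ℝ × ℝ}
    (hI : I ∈ maxIntervals S) : Icc I.1 I.2 ⊆ closure S := by
  rw [← closure_Ioo hI.1.ne]
  exact closure_mono hI.2.1

/-! ### Components -/

variable {T : ContTNorm 0 1} {I J : ℝ × ℝ}

theorem idem_subset : T.idem ⊆ Icc 0 1 := fun _ h => (T.mem_idem.1 h).1

theorem nonIdem_subset_Icc : T.nonIdem ⊆ Icc 0 1 := fun _ h => (T.mem_nonIdem.1 h).1

theorem Icc_subset_idem (hI : I ∈ T.compM) : Icc I.1 I.2 ⊆ T.idem :=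
  T.isClosed_idem.closure_eq ▸ Icc_subset_closure_of_mem_maxIntervals hI

theorem Icc_subset_unit_of_nonIdem (hI : I ∈ maxIntervals T.nonIdem) :
    Icc I.1 I.2 ⊆ Icc 0 1 :=
  (Icc_subset_closure_of_mem_maxIntervals hI).trans
    (closure_minimal nonIdem_subset_Icc isClosed_Icc)

theorem left_mem_idem_of_nonIdem (hI : I ∈ maxIntervals T.nonIdem) : I.1 ∈ T.idem := by
  by_contra h
  exact left_notMem_of_mem_maxIntervals T.isOpen_nonIdem hI (T.mem_nonIdem_iff.2
    ⟨Icc_subset_unit_of_nonIdem hI (left_mem_Icc.2 hI.1.le), h⟩)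

theorem right_mem_idem_of_nonIdem (hI : I ∈ maxIntervals T.nonIdem) : I.2 ∈ T.idem := by
  by_contra h
  exact right_notMem_of_mem_maxIntervals T.isOpen_nonIdem hI (T.mem_nonIdem_iff.2
    ⟨Icc_subset_unit_of_nonIdem hI (right_mem_Icc.2 hI.1.le), h⟩)

/-- Every component of the non-idempotent set is of product or of Łukasiewicz type. -/
theorem mem_compP_union_compL_iff : I ∈ T.compP ∪ T.compL ↔ I ∈ maxIntervals T.nonIdem := by
  refine ⟨fun h => h.elim (·.1) (·.1), fun hI => ?_⟩
  have h₁ := left_mem_idem_of_nonIdem hI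
  have h₂ := right_mem_idem_of_nonIdem hI
  have hR : ∀ T₀, Iso (T.restrict h₁ h₂) T₀ → T.RestrictIso I T₀ := fun T₀ h =>
    ⟨_, fun p q p' q' hp hq => by rw [restrict_apply, ← op_coe, hp, hq], h⟩
  refine (iso_product_or_lukasiewicz hI.1 (T.restrict h₁ h₂) fun p hp => ?_).imp
    (fun h => ⟨hI, hR _ h⟩) fun h => ⟨hI, hR _ h⟩
  by_contra! hne
  have := hI.2.1 ⟨lt_of_le_of_ne p.2.1 hne.1.symm, lt_of_le_of_ne p.2.2 hne.2⟩
  exact (T.mem_nonIdem.1 this).2 (congrArg Subtype.val hp)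

theorem mem_comps_iff :
    I ∈ T.comps ↔ I ∈ maxIntervals T.nonIdem ∨ I ∈ T.compM := by
  rw [← mem_compP_union_compL_iff]
  rfl

theorem lt_of_mem_comps (hI : I ∈ T.comps) : I.1 < I.2 :=
  (mem_comps_iff.1 hI).elim (·.1) (·.1)

theorem left_mem_idem (hI : I ∈ T.comps) : I.1 ∈ T.idem :=
  (mem_comps_iff.1 hI).elim left_mem_idem_of_nonIdem
    fun h => Icc_subset_idem h (left_mem_Icc.2 h.1.le)

theorem right_mem_idem (hI : I ∈ T.comps) : I.2 ∈ T.idem :=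
  (mem_comps_iff.1 hI).elim right_mem_idem_of_nonIdem
    fun h => Icc_subset_idem h (right_mem_Icc.2 h.1.le)

theorem notMem_compM (hI : I ∈ maxIntervals T.nonIdem) : I ∉ T.compM := fun h => by
  obtain ⟨t, ht⟩ := nonempty_Ioo.2 hI.1
  exact (T.mem_nonIdem_iff.1 (hI.2.1 ht)).2 (h.2.1 ht)

/-- Overlapping components are equal. -/
theorem comps_eq_of_overlap (hI : I ∈ T.comps) (hJ : J ∈ T.comps)
    (h : max I.1 J.1 < min I.2 J.2) : I = J := by
  obtain ⟨t, ht⟩ := nonempty_Ioo.2 h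
  have htI : t ∈ Ioo I.1 I.2 := ⟨(le_max_left _ _).trans_lt ht.1, ht.2.trans_le (min_le_left _ _)⟩
  have htJ : t ∈ Ioo J.1 J.2 := ⟨(le_max_right _ _).trans_lt ht.1, ht.2.trans_le (min_le_right _ _)⟩
  rcases mem_comps_iff.1 hI with h1 | h1 <;> rcases mem_comps_iff.1 hJ with h2 | h2
  · exact maxIntervals_eq_of_overlap h1 h2 h
  · exact absurd (h2.2.1 htJ) (T.mem_nonIdem_iff.1 (h1.2.1 htI)).2
  · exact absurd (h1.2.1 htI) (T.mem_nonIdem_iff.1 (h2.2.1 htJ)).2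
  · exact maxIntervals_eq_of_overlap h1 h2 h

theorem comps_eq_of_mem (hI : I ∈ T.comps) (hJ : J ∈ T.comps) {t : ℝ} (htI : t ∈ Ioo I.1 I.2)
    (htJ : t ∈ Ioo J.1 J.2) : I = J :=
  comps_eq_of_overlap hI hJ ((max_lt htI.1 htJ.1).trans (lt_min htI.2 htJ.2))

theorem comps_trichotomy (hI : I ∈ T.comps) (hJ : J ∈ T.comps) :
    I = J ∨ I.2 ≤ J.1 ∨ J.2 ≤ I.1 := by
  by_contra! h
  refine h.1 (comps_eq_of_overlap hI hJ (max_lt (lt_min ?_ ?_) (lt_min ?_ ?_)))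
  exacts [lt_of_mem_comps hI, h.2.2, h.2.1, lt_of_mem_comps hJ]

/-- The components of type `M` have disjoint closures. -/
theorem compM_eq_of_mem (hI : I ∈ T.compM) (hJ : J ∈ T.compM) {t : ℝ} (htI : t ∈ Icc I.1 I.2)
    (htJ : t ∈ Icc J.1 J.2) : I = J := by
  -- Sharing a single end point is enough to merge the two intervals, because `T.idem` is closed and
  -- so contains that point.
  have hU : Ioo (min I.1 J.1) (max I.2 J.2) ⊆ T.idem := by
    refine Ioo_subset_Icc_self.trans ?_
    rw [← Icc_union_Icc' (htJ.1.trans htI.2) (htI.1.trans htJ.2)]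
    exact union_subset (Icc_subset_idem hI) (Icc_subset_idem hJ)
  obtain ⟨h1, h2⟩ := hI.2.2 _ _ (Ioo_subset_Ioo (min_le_left _ _) (le_max_left _ _)) hU
  obtain ⟨h3, h4⟩ := hJ.2.2 _ _ (Ioo_subset_Ioo (min_le_right _ _) (le_max_right _ _)) hU
  exact Prod.ext (h1.symm.trans h3) (h2.symm.trans h4)

theorem exists_maxIntervals_nonIdem {t : ℝ} (ht : t ∈ T.nonIdem) :
    ∃ I ∈ maxIntervals T.nonIdem, t ∈ Ioo I.1 I.2 := by
  obtain ⟨c, d, hcd, hs⟩ := mem_nhds_iff_exists_Ioo_subset.1 (T.isOpen_nonIdem.mem_nhds ht)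
  obtain ⟨I, hI, h1, h2⟩ := exists_maxIntervals nonIdem_subset_Icc (hcd.1.trans hcd.2) hs
  exact ⟨I, hI, h1.trans_lt hcd.1, hcd.2.trans_le h2⟩

/-- The union of the components is dense. -/
theorem exists_mem_comps {p s : ℝ} (hp : 0 ≤ p) (hps : p < s) (hs : s ≤ 1) :
    ∃ I ∈ T.comps, ∃ t ∈ Ioo p s, t ∈ Ioo I.1 I.2 := by
  by_cases h : Ioo p s ⊆ T.idem
  · obtain ⟨I, hI, h1, h2⟩ := exists_maxIntervals idem_subset hps h
    obtain ⟨t, ht⟩ := nonempty_Ioo.2 hps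
    exact ⟨I, mem_comps_iff.2 (Or.inr hI), t, ht, h1.trans_lt ht.1, ht.2.trans_le h2⟩
  · obtain ⟨t, ht, hti⟩ := not_subset.1 h
    obtain ⟨I, hI, htI⟩ := exists_maxIntervals_nonIdem
      (T.mem_nonIdem_iff.2 ⟨⟨hp.trans ht.1.le, ht.2.le.trans hs⟩, hti⟩)
    exact ⟨I, mem_comps_iff.2 (Or.inl hI), t, ht, htI⟩

/-! ### Codes -/

variable (q : ℕ ≃ Icc (0 : ℚ) 1)

theorem exists_index {x y : ℝ} (hx : 0 ≤ x) (hxy : x < y) (hy : y ≤ 1) :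
    ∃ n, (((q n : ℚ)) : ℝ) ∈ Ioo x y := by
  obtain ⟨r, hr1, hr2⟩ := exists_rat_btwn hxy
  have h0 : (0 : ℚ) ≤ r := by exact_mod_cast hx.trans hr1.le
  have h1 : r ≤ (1 : ℚ) := by exact_mod_cast hr2.le.trans hy
  exact ⟨q.symm ⟨r, h0, h1⟩, by simp [hr1, hr2]⟩

theorem index_mem (n : ℕ) : (((q n : ℚ)) : ℝ) ∈ Icc (0 : ℝ) 1 :=
  ⟨by exact_mod_cast (q n).2.1, by exact_mod_cast (q n).2.2⟩

theorem index_injective {m n : ℕ} (h : (((q m : ℚ)) : ℝ) = ((q n : ℚ) : ℝ)) : m = n :=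
  q.injective (Subtype.ext (by exact_mod_cast h))

theorem exists_index_of_mem_comps (hI : I ∈ T.comps) : ∃ n, (((q n : ℚ)) : ℝ) ∈ Ioo I.1 I.2 :=
  exists_index q (idem_subset (left_mem_idem hI)).1 (lt_of_mem_comps hI)
    (idem_subset (right_mem_idem hI)).2

theorem code_of_nonIdem (hI : I ∈ maxIntervals T.nonIdem) :
    T.code q I = sInf {n | (((q n : ℚ)) : ℝ) ∈ Ioo I.1 I.2} :=
  if_pos (mem_compP_union_compL_iff.2 hI)

theorem code_of_compM (hI : I ∈ T.compM) :
    T.code q I = sInf {n | (((q n : ℚ)) : ℝ) ∈ Icc I.1 I.2} :=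
  if_neg fun h => notMem_compM (mem_compP_union_compL_iff.1 h) hI

theorem code_mem_Ioo (hI : I ∈ maxIntervals T.nonIdem) :
    ((q (T.code q I) : ℚ) : ℝ) ∈ Ioo I.1 I.2 := by
  rw [code_of_nonIdem q hI]
  exact Nat.sInf_mem (exists_index_of_mem_comps q (mem_comps_iff.2 (Or.inl hI)))

theorem code_mem_Icc (hI : I ∈ T.comps) : ((q (T.code q I) : ℚ) : ℝ) ∈ Icc I.1 I.2 := by
  rcases mem_comps_iff.1 hI with h | h
  · exact Ioo_subset_Icc_self (code_mem_Ioo q h)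
  · rw [code_of_compM q h]
    obtain ⟨n, hn⟩ := exists_index_of_mem_comps q hI
    exact Nat.sInf_mem (s := {n | (((q n : ℚ)) : ℝ) ∈ Icc I.1 I.2}) ⟨n, Ioo_subset_Icc_self hn⟩

theorem code_eq_iff_of_nonIdem (hI : I ∈ maxIntervals T.nonIdem) (n : ℕ) :
    T.code q I = n ↔ ((q n : ℚ) : ℝ) ∈ Ioo I.1 I.2 ∧
      ∀ m < n, ((q m : ℚ) : ℝ) ∉ Ioo I.1 I.2 := by
  rw [code_of_nonIdem q hI]
  have hne := exists_index_of_mem_comps q (mem_comps_iff.2 (Or.inl hI))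
  constructor
  · rintro rfl
    exact ⟨Nat.sInf_mem hne, fun m hm => Nat.notMem_of_lt_sInf hm⟩
  · rintro ⟨h1, h2⟩
    exact le_antisymm (Nat.sInf_le h1) (le_of_not_gt fun h => h2 _ h (Nat.sInf_mem hne))

theorem code_eq_iff_of_compM (hI : I ∈ T.compM) (n : ℕ) :
    T.code q I = n ↔ ((q n : ℚ) : ℝ) ∈ Icc I.1 I.2 ∧
      ∀ m < n, ((q m : ℚ) : ℝ) ∉ Icc I.1 I.2 := by
  rw [code_of_compM q hI]
  have hne : {n | (((q n : ℚ)) : ℝ) ∈ Icc I.1 I.2}.Nonempty := by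
    obtain ⟨n, hn⟩ := exists_index_of_mem_comps q (mem_comps_iff.2 (Or.inr hI))
    exact ⟨n, Ioo_subset_Icc_self hn⟩
  constructor
  · rintro rfl
    exact ⟨Nat.sInf_mem hne, fun m hm => Nat.notMem_of_lt_sInf hm⟩
  · rintro ⟨h1, h2⟩
    exact le_antisymm (Nat.sInf_le h1) (le_of_not_gt fun h => h2 _ h (Nat.sInf_mem hne))

/-- The rational behind a code is non-idempotent for a component of type P or Ł and idempotent for
one of type M, so the two kinds cannot collide. Within one kind, the open intervals, respectively
the closed ones, are disjoint. -/
theorem code_injOn : InjOn (T.code q) T.comps := fun I hI J hJ h => by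
  have h1 := code_mem_Icc q hI
  have h2 := code_mem_Icc q hJ
  rw [← h] at h2
  rcases mem_comps_iff.1 hI with hI' | hI' <;> rcases mem_comps_iff.1 hJ with hJ' | hJ'
  · exact comps_eq_of_mem hI hJ (code_mem_Ioo q hI') (h ▸ code_mem_Ioo q hJ')
  · exact absurd (Icc_subset_idem hJ' h2)
      (T.mem_nonIdem_iff.1 (hI'.2.1 (code_mem_Ioo q hI'))).2
  · exact absurd (Icc_subset_idem hI' h1)
      (T.mem_nonIdem_iff.1 (hJ'.2.1 (h ▸ code_mem_Ioo q hJ'))).2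
  · exact compM_eq_of_mem hI' hJ' h1 h2

/-- A rational of an open component whose index is a code encodes that component. -/
theorem eq_of_code_mem_Ioo (hI : I ∈ T.comps) (hJ : J ∈ T.comps)
    (h : ((q (T.code q J) : ℚ) : ℝ) ∈ Ioo I.1 I.2) : I = J := by
  rcases comps_trichotomy hI hJ with h1 | h1 | h1
  · exact h1
  · exact absurd (h.2.trans_le (h1.trans (code_mem_Icc q hJ).1)) (lt_irrefl _)
  · exact absurd (h.1.trans_le ((code_mem_Icc q hJ).2.trans h1)) (lt_irrefl _)

/-- The order of two components becomes the order of two fixed rationals, a condition in which the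
t-norm no longer occurs once the codes are given. Neighbouring closed intervals may share an end
point, so strictness relies on injectivity of the codes. -/
theorem code_lt_iff (hI : I ∈ T.comps) (hJ : J ∈ T.comps) :
    I.2 ≤ J.1 ↔ ((q (T.code q I) : ℚ) : ℝ) < (q (T.code q J) : ℚ) := by
  have h1 := code_mem_Icc q hI
  have h2 := code_mem_Icc q hJ
  constructor
  · intro h
    refine lt_of_le_of_ne (h1.2.trans (h.trans h2.1)) fun heq => ?_
    have := code_injOn q hI hJ (index_injective q heq)
    subst this
    exact (lt_of_mem_comps hI).not_ge h
  · intro h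
    rcases comps_trichotomy hI hJ with rfl | h3 | h3
    · exact absurd h (lt_irrefl _)
    · exact h3
    · exact absurd (h.trans_le (h2.2.trans (h3.trans h1.1))) (lt_irrefl _)

/-! ### The relations of the coding structure -/

theorem toModL1_lt_iff (k : Fin 2 → ℕ) : T.toModL1 q .lt k = true ↔
    ∃ I ∈ T.comps, ∃ J ∈ T.comps, T.code q I = k 0 ∧ T.code q J = k 1 ∧ I.2 ≤ J.1 :=
  @decide_eq_true_iff _ (Classical.propDecidable _)

theorem toModL1_P_iff (k : Fin 1 → ℕ) : T.toModL1 q .P k = true ↔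
    ∃ I ∈ T.compP, T.code q I = k 0 :=
  @decide_eq_true_iff _ (Classical.propDecidable _)

theorem toModL1_L_iff (k : Fin 1 → ℕ) : T.toModL1 q .L k = true ↔
    ∃ I ∈ T.compL, T.code q I = k 0 :=
  @decide_eq_true_iff _ (Classical.propDecidable _)

theorem toModL1_M_iff (k : Fin 1 → ℕ) : T.toModL1 q .M k = true ↔
    ∃ I ∈ T.compM, T.code q I = k 0 :=
  @decide_eq_true_iff _ (Classical.propDecidable _)

theorem toModL1_lt_code_iff (hI : I ∈ T.comps) (hJ : J ∈ T.comps) :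
    T.toModL1 q .lt ![T.code q I, T.code q J] = true ↔ I.2 ≤ J.1 := by
  rw [toModL1_lt_iff]
  constructor
  · rintro ⟨I', hI', J', hJ', h1, h2, h⟩
    rwa [code_injOn q hI' hI h1, code_injOn q hJ' hJ h2] at h
  · exact fun h => ⟨I, hI, J, hJ, rfl, rfl, h⟩

end ContTNorm

namespace ContTNorm

/-! ### Isomorphic t-norms have isomorphic coding structures -/

theorem map_mem_maxIntervals {S₁ S₂ : Set ℝ} (f : ℝ ≃o ℝ) (hf : ∀ x, f x ∈ S₂ ↔ x ∈ S₁)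
    {I : ℝ × ℝ} (hI : I ∈ maxIntervals S₁) : (f I.1, f I.2) ∈ maxIntervals S₂ := by
  have hs : ∀ x y, Ioo (f x) (f y) ⊆ S₂ ↔ Ioo x y ⊆ S₁ := fun x y => by
    rw [← f.image_Ioo, image_subset_iff]
    exact forall₂_congr fun t _ => hf t
  refine ⟨f.strictMono hI.1, (hs _ _).2 hI.2.1, fun c d hcd h => ?_⟩
  obtain ⟨c, rfl⟩ := f.surjective c
  obtain ⟨d, rfl⟩ := f.surjective d
  rw [hs] at h
  rw [← f.image_Ioo, ← f.image_Ioo, image_subset_image_iff f.injective] at hcd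
  obtain ⟨rfl, rfl⟩ := hI.2.2 c d hcd h
  exact ⟨rfl, rfl⟩

variable {T₁ T₂ : ContTNorm 0 1} {f : ℝ ≃o ℝ} {I : ℝ × ℝ}

theorem map_mem_idem (hf : IsIntervalIso T₁.op T₂.op 0 1 0 1 f) {x : ℝ} (hx : x ∈ T₁.idem) :
    f x ∈ T₂.idem := by
  obtain ⟨hx, h⟩ := T₁.mem_idem.1 hx
  exact T₂.mem_idem.2 ⟨hf.mem hx, by rw [← hf.map_op x hx x hx, h]⟩

theorem map_mem_idem_iff (hf : IsIntervalIso T₁.op T₂.op 0 1 0 1 f) (x : ℝ) :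
    f x ∈ T₂.idem ↔ x ∈ T₁.idem :=
  ⟨fun h => by simpa using map_mem_idem hf.symm h, map_mem_idem hf⟩

theorem map_mem_nonIdem_iff (hf : IsIntervalIso T₁.op T₂.op 0 1 0 1 f) (x : ℝ) :
    f x ∈ T₂.nonIdem ↔ x ∈ T₁.nonIdem := by
  rw [mem_nonIdem_iff, mem_nonIdem_iff, map_mem_idem_iff hf]
  refine and_congr_left fun _ => ⟨fun h => by simpa using hf.symm.mem h, hf.mem⟩

theorem map_restrictIso (hf : IsIntervalIso T₁.op T₂.op 0 1 0 1 f)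
    (hI : I ∈ maxIntervals T₁.nonIdem) {T₀ : ContTNorm 0 1} (h : T₁.RestrictIso I T₀) :
    T₂.RestrictIso (f I.1, f I.2) T₀ := by
  have hJ := map_mem_maxIntervals f (map_mem_nonIdem_iff hf) hI
  have h₁ := left_mem_idem_of_nonIdem hI
  have h₂ := right_mem_idem_of_nonIdem hI
  rw [restrictIso_iff h₁ h₂ hI.1.le] at h
  rw [restrictIso_iff (left_mem_idem_of_nonIdem hJ) (right_mem_idem_of_nonIdem hJ) hJ.1.le]
  obtain ⟨g, hg⟩ := h
  exact ⟨_, (hf.mono (idem_subset h₁).1 (idem_subset h₂).2).symm.trans hg⟩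

theorem map_mem_compP (hf : IsIntervalIso T₁.op T₂.op 0 1 0 1 f) (hI : I ∈ T₁.compP) :
    (f I.1, f I.2) ∈ T₂.compP :=
  ⟨map_mem_maxIntervals f (map_mem_nonIdem_iff hf) hI.1, map_restrictIso hf hI.1 hI.2⟩

theorem map_mem_compL (hf : IsIntervalIso T₁.op T₂.op 0 1 0 1 f) (hI : I ∈ T₁.compL) :
    (f I.1, f I.2) ∈ T₂.compL :=
  ⟨map_mem_maxIntervals f (map_mem_nonIdem_iff hf) hI.1, map_restrictIso hf hI.1 hI.2⟩

theorem map_mem_compM (hf : IsIntervalIso T₁.op T₂.op 0 1 0 1 f) (hI : I ∈ T₁.compM) :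
    (f I.1, f I.2) ∈ T₂.compM :=
  map_mem_maxIntervals f (map_mem_idem_iff hf) hI

theorem map_mem_comps (hf : IsIntervalIso T₁.op T₂.op 0 1 0 1 f) (hI : I ∈ T₁.comps) :
    (f I.1, f I.2) ∈ T₂.comps :=
  hI.imp (Or.imp (map_mem_compP hf) (map_mem_compL hf)) (map_mem_compM hf)

/-- The bijection between components induced by an isomorphism. -/
def compsEquiv (hf : IsIntervalIso T₁.op T₂.op 0 1 0 1 f) : T₁.comps ≃ T₂.comps where
  toFun I := ⟨_, map_mem_comps hf I.2⟩
  invFun I := ⟨_, map_mem_comps hf.symm I.2⟩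
  left_inv I := by simp
  right_inv I := by simp

/-- A single component contains infinitely many rationals, of which at most one carries a code. -/
theorem infinite_compl_codes (q : ℕ ≃ Icc (0 : ℚ) 1) (T : ContTNorm 0 1) :
    (T.code q '' T.comps)ᶜ.Infinite := by
  obtain ⟨I, hI, -⟩ := exists_mem_comps (T := T) le_rfl zero_lt_one le_rfl
  have hN : ({n | (((q n : ℚ)) : ℝ) ∈ Ioo I.1 I.2} \ {T.code q I} : Set ℕ).Infinite := by
    refine Infinite.sdiff (fun hfin => ?_) (finite_singleton _)
    have h0 := (idem_subset (left_mem_idem hI)).1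
    have h1 := (idem_subset (right_mem_idem hI)).2
    obtain ⟨n₀, hn₀⟩ := exists_index_of_mem_comps q hI
    obtain ⟨n, hn, hmax⟩ := exists_max_image _ (fun n => (((q n : ℚ)) : ℝ)) hfin ⟨n₀, hn₀⟩
    obtain ⟨m, hm⟩ := exists_index q (h0.trans hn.1.le) hn.2 h1
    exact (hmax m ⟨hn.1.trans hm.1, hm.2⟩).not_gt hm.1
  refine hN.mono fun n hn => ?_
  rintro ⟨J, hJ, rfl⟩
  exact hn.2 (by rw [eq_of_code_mem_Ioo q hI hJ hn.1]; rfl)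

/-- On codes the bijection is forced by the map of components. Both sets of non-codes are countably
infinite, and any bijection between them will do because non-codes lie in no relation. -/
theorem exists_equiv_codes (q : ℕ ≃ Icc (0 : ℚ) 1) (hf : IsIntervalIso T₁.op T₂.op 0 1 0 1 f) :
    ∃ ξ : ℕ ≃ ℕ, ∀ I ∈ T₁.comps, ξ (T₁.code q I) = T₂.code q (f I.1, f I.2) := by
  classical
  obtain ⟨d₁⟩ := nonempty_denumerable_iff.2
    ⟨inferInstance, (infinite_compl_codes q T₁).to_subtype⟩
  obtain ⟨d₂⟩ := nonempty_denumerable_iff.2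
    ⟨inferInstance, (infinite_compl_codes q T₂).to_subtype⟩
  let e₁ := Equiv.Set.imageOfInjOn _ _ (code_injOn (T := T₁) q)
  let e₂ := Equiv.Set.imageOfInjOn _ _ (code_injOn (T := T₂) q)
  let e := (e₁.symm.trans (compsEquiv hf)).trans e₂
  refine ⟨((Equiv.Set.sumCompl (T₁.code q '' T₁.comps)).symm.trans
    (Equiv.sumCongr e (Denumerable.equiv₂ _ _))).trans (Equiv.Set.sumCompl _), fun I hI => ?_⟩
  have h : (⟨T₁.code q I, mem_image_of_mem _ hI⟩ : T₁.code q '' T₁.comps) = e₁ ⟨I, hI⟩ := rfl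
  rw [Equiv.trans_apply, Equiv.trans_apply,
    Equiv.Set.sumCompl_symm_apply_of_mem (mem_image_of_mem _ hI), h]
  simp only [Equiv.sumCongr_apply, Sum.map_inl, Equiv.Set.sumCompl_apply_inl, e,
    Equiv.trans_apply, Equiv.symm_apply_apply]
  rfl

/-- Only preservation is shown, for a map `ξ` that need not be bijective; reflection follows by
applying it to the inverse isomorphism. -/
theorem toModL1_map (q : ℕ ≃ Icc (0 : ℚ) 1) (hf : IsIntervalIso T₁.op T₂.op 0 1 0 1 f)
    {ξ : ℕ → ℕ} (hξ : ∀ I ∈ T₁.comps, ξ (T₁.code q I) = T₂.code q (f I.1, f I.2))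
    (i : L1Symbol) (k : Fin i.arity → ℕ) (h : T₁.toModL1 q i k = true) :
    T₂.toModL1 q i (fun j => ξ (k j)) = true := by
  cases i with
  | lt =>
    obtain ⟨I, hI, J, hJ, h1, h2, h3⟩ := (toModL1_lt_iff q k).1 h
    exact (toModL1_lt_iff q _).2 ⟨_, map_mem_comps hf hI, _, map_mem_comps hf hJ,
      by rw [← hξ I hI, h1], by rw [← hξ J hJ, h2], f.monotone h3⟩
  | P =>
    obtain ⟨I, hI, h1⟩ := (toModL1_P_iff q k).1 h
    exact (toModL1_P_iff q _).2 ⟨_, map_mem_compP hf hI,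
      by rw [← hξ I (Or.inl (Or.inl hI)), h1]⟩
  | L =>
    obtain ⟨I, hI, h1⟩ := (toModL1_L_iff q k).1 h
    exact (toModL1_L_iff q _).2 ⟨_, map_mem_compL hf hI,
      by rw [← hξ I (Or.inl (Or.inr hI)), h1]⟩
  | M =>
    obtain ⟨I, hI, h1⟩ := (toModL1_M_iff q k).1 h
    exact (toModL1_M_iff q _).2 ⟨_, map_mem_compM hf hI, by rw [← hξ I (Or.inr hI), h1]⟩

theorem toModL1_iso_of_iso (q : ℕ ≃ Icc (0 : ℚ) 1) (h : Iso T₁ T₂) :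
    ModSpace.isoSetoid L1Symbol.arity (T₁.toModL1 q) (T₂.toModL1 q) := by
  obtain ⟨f, hf⟩ := iso_iff.1 h
  obtain ⟨ξ, hξ⟩ := exists_equiv_codes q hf
  refine ⟨ξ, fun i k => ⟨toModL1_map q hf hξ i k, fun h => ?_⟩⟩
  have := toModL1_map q hf.symm (ξ := ξ.symm) (fun I hI => ?_) i _ h
  · simpa using this
  · rw [Equiv.symm_apply_eq, hξ _ (map_mem_comps hf.symm hI)]
    simp

end ContTNorm

/-! ### Isomorphic coding structures come from isomorphic t-norms -/

/-- A strictly increasing map between dense subsets of the unit interval extends to an order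
automorphism. -/
theorem exists_orderIso_of_strictMonoOn {D : Set ℝ} {g : ℝ → ℝ} (hg : StrictMonoOn g D)
    (himg : ∀ t ∈ D, g t ∈ Icc (0 : ℝ) 1)
    (hD : ∀ p s : ℝ, 0 ≤ p → p < s → s ≤ 1 → ∃ t ∈ D, t ∈ Ioo p s)
    (hD' : ∀ p s : ℝ, 0 ≤ p → p < s → s ≤ 1 → ∃ t ∈ D, g t ∈ Ioo p s)
    (hD01 : D ⊆ Icc 0 1) :
    ∃ F : ℝ ≃o ℝ, F 0 = 0 ∧ F 1 = 1 ∧ ∀ t ∈ D, F t = g t := by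
  -- The extension is the supremum of the values of `g` to the left; inserting `0` keeps the set
  -- nonempty and the supremum nonnegative.
  let A : ℝ → Set ℝ := fun x => insert 0 (g '' (D ∩ Iic x))
  have hA : ∀ x, A x ⊆ Icc 0 1 := fun x => by
    rintro _ (rfl | ⟨t, ht, rfl⟩)
    exacts [by simp, himg t ht.1]
  have hAb : ∀ x, BddAbove (A x) := fun x => ⟨1, fun y hy => (hA x hy).2⟩
  have hmem : ∀ x, sSup (A x) ∈ Icc (0 : ℝ) 1 := fun x =>
    ⟨le_csSup (hAb x) (mem_insert _ _), csSup_le (insert_nonempty _ _) fun y hy => (hA x hy).2⟩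
  have hmono : Monotone fun x => sSup (A x) := fun x y hxy =>
    csSup_le_csSup (hAb y) (insert_nonempty _ _)
      (insert_subset_insert (image_mono (inter_subset_inter_right _ (Iic_subset_Iic.2 hxy))))
  have hval : ∀ t ∈ D, sSup (A t) = g t := fun t ht => by
    refine le_antisymm (csSup_le (insert_nonempty _ _) ?_)
      (le_csSup (hAb t) (mem_insert_of_mem _ ⟨t, ⟨ht, mem_Iic.2 le_rfl⟩, rfl⟩))
    rintro _ (rfl | ⟨s, hs, rfl⟩)
    exacts [(himg t ht).1, hg.monotoneOn hs.1 ht hs.2]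
  let ψ : Icc (0 : ℝ) 1 → Icc (0 : ℝ) 1 := fun x => ⟨sSup (A x), hmem x⟩
  have hψ : StrictMono ψ := fun x y hxy => by
    obtain ⟨s, hs, hsx, hsy⟩ := hD x y x.2.1 hxy y.2.2
    obtain ⟨t, ht, hts, hty⟩ := hD s y (x.2.1.trans hsx.le) hsy y.2.2
    change sSup (A x) < sSup (A y)
    calc sSup (A x) ≤ sSup (A s) := hmono hsx.le
      _ = g s := hval s hs
      _ < g t := hg hs ht hts
      _ = sSup (A t) := (hval t ht).symm
      _ ≤ sSup (A y) := hmono hty.le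
  have hdense : DenseRange ψ := dense_of_exists_between fun x y hxy => by
    obtain ⟨t, ht, h1, h2⟩ := hD' x y x.2.1 hxy y.2.2
    refine ⟨_, ⟨⟨t, hD01 ht⟩, rfl⟩, ?_, ?_⟩
    · change (x : ℝ) < sSup (A t)
      rwa [hval t ht]
    · change sSup (A t) < (y : ℝ)
      rwa [hval t ht]
  -- A monotone map with dense range has no jumps, and by compactness its range is closed, hence
  -- everything.
  have hcont : Continuous ψ := hψ.monotone.continuous_of_denseRange hdense
  have hsurj : Function.Surjective ψ := by
    rw [← range_eq_univ, ← (isCompact_range hcont).isClosed.closure_eq]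
    exact hdense.closure_eq
  obtain ⟨F, hF⟩ := exists_orderIso_real_extend zero_le_one (hψ.orderIsoOfSurjective ψ hsurj)
  refine ⟨F, (hF ⟨0, by simp⟩).trans (OrderIso.apply_left_Icc zero_le_one _),
    (hF ⟨1, by simp⟩).trans (OrderIso.apply_right_Icc zero_le_one _), fun t ht => ?_⟩
  exact (hF ⟨t, hD01 ht⟩).trans (hval t ht)

namespace ContTNorm

variable {T₁ T₂ : ContTNorm 0 1}

theorem op_eq_min {T : ContTNorm 0 1} {p q : ℝ} (hp : p ∈ T.idem) (hq : q ∈ T.idem) :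
    T.op p q = min p q := by
  rcases le_total p q with h | h
  · rw [min_eq_left h]
    exact T.op_of_idem_between hp (idem_subset hp).1 le_rfl h (idem_subset hq).2
  · rw [min_eq_right h, op_comm]
    exact T.op_of_idem_between hq (idem_subset hq).1 le_rfl h (idem_subset hp).2

theorem exists_orderIso_endpoints {a b c d : ℝ} (hab : a < b) (hcd : c < d) :
    ∃ f : ℝ ≃o ℝ, f a = c ∧ f b = d := by
  have hr : 0 < (d - c) / (b - a) := div_pos (sub_pos.2 hcd) (sub_pos.2 hab)
  have hb : b - a ≠ 0 := (sub_pos.2 hab).ne'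
  refine ⟨((OrderIso.addRight (-a)).trans (OrderIso.mulRight₀ _ hr)).trans (OrderIso.addRight c),
    by simp, ?_⟩
  simp only [OrderIso.trans_apply, OrderIso.addRight_apply, OrderIso.mulRight₀_apply]
  field_simp
  ring

/-- On idempotents the operation is the minimum, which every increasing bijection preserves, so an
affine map suffices. -/
theorem exists_intervalIso_of_compM {I J : ℝ × ℝ} (hI : I ∈ T₁.compM) (hJ : J ∈ T₂.compM) :
    ∃ f, IsIntervalIso T₁.op T₂.op I.1 I.2 J.1 J.2 f := by
  obtain ⟨f, h1, h2⟩ := exists_orderIso_endpoints hI.1 hJ.1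
  have hf : ∀ p ∈ Icc I.1 I.2, f p ∈ T₂.idem := fun p hp =>
    Icc_subset_idem hJ ⟨h1 ▸ f.monotone hp.1, h2 ▸ f.monotone hp.2⟩
  refine ⟨f, h1, h2, fun p hp q hq => ?_⟩
  rw [op_eq_min (Icc_subset_idem hI hp) (Icc_subset_idem hI hq), op_eq_min (hf p hp) (hf q hq)]
  exact f.monotone.map_min

theorem exists_intervalIso_of_restrictIso {I J : ℝ × ℝ} (hI : I ∈ maxIntervals T₁.nonIdem)
    (hJ : J ∈ maxIntervals T₂.nonIdem) {T₀ : ContTNorm 0 1} (h₁ : T₁.RestrictIso I T₀)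
    (h₂ : T₂.RestrictIso J T₀) : ∃ f, IsIntervalIso T₁.op T₂.op I.1 I.2 J.1 J.2 f := by
  obtain ⟨f, hf⟩ := (restrictIso_iff (left_mem_idem_of_nonIdem hI)
    (right_mem_idem_of_nonIdem hI) hI.1.le).1 h₁
  obtain ⟨g, hg⟩ := (restrictIso_iff (left_mem_idem_of_nonIdem hJ)
    (right_mem_idem_of_nonIdem hJ) hJ.1.le).1 h₂
  exact ⟨_, hf.trans hg.symm⟩

theorem exists_component_of_iso (q : ℕ ≃ Icc (0 : ℚ) 1) {ξ : ℕ → ℕ}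
    (hξ : ∀ (i : L1Symbol) (k : Fin i.arity → ℕ), T₁.toModL1 q i k = true →
      T₂.toModL1 q i (fun j => ξ (k j)) = true) {I : ℝ × ℝ} (hI : I ∈ T₁.comps) :
    ∃ J ∈ T₂.comps, T₂.code q J = ξ (T₁.code q I) ∧
      ∃ f, IsIntervalIso T₁.op T₂.op I.1 I.2 J.1 J.2 f := by
  rcases hI with (hI | hI) | hI
  · obtain ⟨J, hJ, h⟩ := (toModL1_P_iff q _).1
      (hξ .P (fun _ => T₁.code q I) ((toModL1_P_iff q _).2 ⟨I, hI, rfl⟩))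
    exact ⟨J, Or.inl (Or.inl hJ), h, exists_intervalIso_of_restrictIso hI.1 hJ.1 hI.2 hJ.2⟩
  · obtain ⟨J, hJ, h⟩ := (toModL1_L_iff q _).1
      (hξ .L (fun _ => T₁.code q I) ((toModL1_L_iff q _).2 ⟨I, hI, rfl⟩))
    exact ⟨J, Or.inl (Or.inr hJ), h, exists_intervalIso_of_restrictIso hI.1 hJ.1 hI.2 hJ.2⟩
  · obtain ⟨J, hJ, h⟩ := (toModL1_M_iff q _).1
      (hξ .M (fun _ => T₁.code q I) ((toModL1_M_iff q _).2 ⟨I, hI, rfl⟩))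
    exact ⟨J, Or.inr hJ, h, exists_intervalIso_of_compM hI hJ⟩

/-- Isomorphisms between corresponding components assemble to an isomorphism of t-norms. -/
theorem iso_of_components (J : ℝ × ℝ → ℝ × ℝ) (f : ℝ × ℝ → ℝ ≃o ℝ)
    (hJ : ∀ I ∈ T₁.comps, J I ∈ T₂.comps)
    (hf : ∀ I ∈ T₁.comps, IsIntervalIso T₁.op T₂.op I.1 I.2 (J I).1 (J I).2 (f I))
    (hlt : ∀ I ∈ T₁.comps, ∀ I' ∈ T₁.comps, I.2 ≤ I'.1 → (J I).2 ≤ (J I').1)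
    (hsurj : ∀ K ∈ T₂.comps, ∃ I ∈ T₁.comps, J I = K) : Iso T₁ T₂ := by
  classical
  let D : Set ℝ := {t | ∃ I ∈ T₁.comps, t ∈ Ioo I.1 I.2}
  let g : ℝ → ℝ := fun t => if h : ∃ I ∈ T₁.comps, t ∈ Ioo I.1 I.2 then f h.choose t else 0
  have hg : ∀ I ∈ T₁.comps, ∀ t ∈ Ioo I.1 I.2, g t = f I t := fun I hI t ht => by
    have h : ∃ I ∈ T₁.comps, t ∈ Ioo I.1 I.2 := ⟨I, hI, ht⟩
    simp only [g, dif_pos h]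
    rw [comps_eq_of_mem h.choose_spec.1 hI h.choose_spec.2 ht]
  have hfI : ∀ I ∈ T₁.comps, ∀ t ∈ Ioo I.1 I.2, f I t ∈ Ioo (J I).1 (J I).2 := fun I hI t ht =>
    ⟨(hf I hI).map_left ▸ (f I).strictMono ht.1, (hf I hI).map_right ▸ (f I).strictMono ht.2⟩
  have hD01 : D ⊆ Icc 0 1 := fun t ⟨I, hI, ht⟩ =>
    ⟨(idem_subset (left_mem_idem hI)).1.trans ht.1.le,
      ht.2.le.trans (idem_subset (right_mem_idem hI)).2⟩
  have hmono : StrictMonoOn g D := by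
    rintro s ⟨I, hI, hs⟩ t ⟨I', hI', ht⟩ hst
    rw [hg I hI s hs, hg I' hI' t ht]
    rcases comps_trichotomy hI hI' with rfl | h | h
    · exact (f I).strictMono hst
    · exact (hfI I hI s hs).2.trans_le ((hlt I hI I' hI' h).trans (hfI I' hI' t ht).1.le)
    · exact absurd (hst.trans (ht.2.trans_le (h.trans hs.1.le))) (lt_irrefl _)
  obtain ⟨F, hF0, hF1, hF⟩ := exists_orderIso_of_strictMonoOn hmono
    (by
      rintro t ⟨I, hI, ht⟩
      rw [hg I hI t ht]
      have := hfI I hI t ht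
      exact ⟨(idem_subset (left_mem_idem (hJ I hI))).1.trans this.1.le,
        this.2.le.trans (idem_subset (right_mem_idem (hJ I hI))).2⟩)
    (fun p s hp hps hs => by
      obtain ⟨I, hI, t, ht, htI⟩ := exists_mem_comps (T := T₁) hp hps hs
      exact ⟨t, ⟨I, hI, htI⟩, ht⟩)
    (fun p s hp hps hs => by
      obtain ⟨K, hK, t, ht, htK⟩ := exists_mem_comps (T := T₂) hp hps hs
      obtain ⟨I, hI, rfl⟩ := hsurj K hK
      have hmem : (f I).symm t ∈ Ioo I.1 I.2 :=
        ⟨(f I).lt_symm_apply.2 ((hf I hI).map_left ▸ htK.1),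
          (f I).symm_apply_lt.2 ((hf I hI).map_right ▸ htK.2)⟩
      refine ⟨(f I).symm t, ⟨I, hI, hmem⟩, ?_⟩
      rwa [hg I hI _ hmem, OrderIso.apply_symm_apply])
    hD01
  have hFI : ∀ I ∈ T₁.comps, EqOn F (f I) (Icc I.1 I.2) := fun I hI => by
    have : EqOn F (f I) (Ioo I.1 I.2) := fun t ht => by
      rw [hF t ⟨I, hI, ht⟩, hg I hI t ht]
    have := this.closure F.continuous (f I).continuous
    rwa [closure_Ioo (lt_of_mem_comps hI).ne] at this
  -- For points of different components, the right end of the lower component is a separating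
  -- idempotent on both sides, so both products are the smaller factor.
  have hsep : ∀ I ∈ T₁.comps, ∀ I' ∈ T₁.comps, I.2 ≤ I'.1 → ∀ p ∈ Ioo I.1 I.2,
      ∀ r ∈ Ioo I'.1 I'.2, F (T₁.op p r) = T₂.op (F p) (F r) := by
    intro I hI I' hI' h p hp r hr
    have hp2 := hfI I hI p hp
    have hr2 := hfI I' hI' r hr
    rw [hFI I hI (Ioo_subset_Icc_self hp), hFI I' hI' (Ioo_subset_Icc_self hr)]
    rw [T₁.op_of_idem_between (right_mem_idem hI) (hD01 ⟨I, hI, hp⟩).1 hp.2.le (h.trans hr.1.le)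
        (hD01 ⟨I', hI', hr⟩).2,
      T₂.op_of_idem_between (right_mem_idem (hJ I hI))
        ((idem_subset (left_mem_idem (hJ I hI))).1.trans hp2.1.le) hp2.2.le
        ((hlt I hI I' hI' h).trans hr2.1.le)
        (hr2.2.le.trans (idem_subset (right_mem_idem (hJ I' hI'))).2),
      hFI I hI (Ioo_subset_Icc_self hp)]
  have hclos : Icc (0 : ℝ) 1 ⊆ closure D := by
    rw [← closure_Ioo zero_ne_one]
    refine closure_minimal (fun x hx => mem_closure_iff.2 fun o ho hxo => ?_) isClosed_closure
    obtain ⟨c, d, hcd, hs⟩ := mem_nhds_iff_exists_Ioo_subset.1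
      ((ho.inter isOpen_Ioo).mem_nhds ⟨hxo, hx⟩)
    have hcl := closure_minimal (hs.trans inter_subset_right |>.trans Ioo_subset_Icc_self)
      isClosed_Icc
    rw [closure_Ioo (hcd.1.trans hcd.2).ne] at hcl
    have hle := (hcd.1.trans hcd.2).le
    obtain ⟨I, hI, t, ht, htI⟩ := exists_mem_comps (T := T₁) (hcl (left_mem_Icc.2 hle)).1
      (hcd.1.trans hcd.2) (hcl (right_mem_Icc.2 hle)).2
    exact ⟨t, (hs ht).1, I, hI, htI⟩
  have hFc : Continuous F := F.continuous
  -- Checking the identity on the dense set `D ×ˢ D` is enough: points outside all open components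
  -- are covered by continuity.
  have heq : EqOn (fun x : ℝ × ℝ => F (T₁.op x.1 x.2)) (fun x => T₂.op (F x.1) (F x.2))
      (D ×ˢ D) := by
    rintro ⟨p, r⟩ ⟨⟨I, hI, hp⟩, I', hI', hr⟩
    simp only at hp hr ⊢
    rcases comps_trichotomy hI hI' with rfl | h | h
    · have hp' := Ioo_subset_Icc_self hp
      have hr' := Ioo_subset_Icc_self hr
      rw [hFI I hI (T₁.op_mem_Icc (left_mem_idem hI) (right_mem_idem hI) hp' hr'), hFI I hI hp',
        hFI I hI hr', (hf I hI).map_op p hp' r hr']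
    · exact hsep I hI I' hI' h p hp r hr
    · rw [T₁.op_comm, T₂.op_comm]
      exact hsep I' hI' I hI h r hr p hp
  have hext := heq.closure (hFc.comp T₁.continuous_op)
    (T₂.continuous_op.comp ((hFc.comp continuous_fst).prodMk (hFc.comp continuous_snd)))
  rw [closure_prod_eq] at hext
  exact iso_iff.2 ⟨F, hF0, hF1, fun p hp r hr =>
    hext (x := (p, r)) ⟨hclos hp, hclos hr⟩⟩

theorem iso_of_toModL1_iso (q : ℕ ≃ Icc (0 : ℚ) 1)
    (h : ModSpace.isoSetoid L1Symbol.arity (T₁.toModL1 q) (T₂.toModL1 q)) : Iso T₁ T₂ := by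
  obtain ⟨ξ, hξ⟩ := h
  choose! J hJ hcode f hf using fun I (hI : I ∈ T₁.comps) =>
    exists_component_of_iso q (ξ := ξ) (fun i k => (hξ i k).1) hI
  refine iso_of_components J f hJ hf (fun I hI I' hI' h => ?_) fun K hK => ?_
  · rw [← toModL1_lt_code_iff q hI hI'] at h
    have := (hξ .lt ![T₁.code q I, T₁.code q I']).1 h
    rw [← toModL1_lt_code_iff q (hJ I hI) (hJ I' hI'), hcode I hI, hcode I' hI']
    have hk : (fun j : Fin 2 => ξ (![T₁.code q I, T₁.code q I'] j)) =
        ![ξ (T₁.code q I), ξ (T₁.code q I')] := by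
      funext j
      fin_cases j <;> rfl
    rwa [← hk]
  -- Surjectivity on components comes from the inverse bijection, combined with injectivity of the
  -- codes.
  · obtain ⟨I, hI, h1, -⟩ := exists_component_of_iso (T₁ := T₂) (T₂ := T₁) q (ξ := ξ.symm)
      (fun i k h => by rw [hξ]; simpa using h) hK
    exact ⟨I, hI, code_injOn q (hJ I hI) hK (by rw [hcode I hI, h1, ξ.apply_symm_apply])⟩

end ContTNorm

namespace ContTNorm

/-! ### Recognizing components and their types from countably many conditions -/

variable {T : ContTNorm 0 1} {I : ℝ × ℝ} {r s : ℝ}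

/-- Membership in the component of `r` is expressed without its end points, which depend on `T`:
points outside it are separated from `r` by an idempotent. -/
theorem mem_Ioo_iff_of_nonIdem (hI : I ∈ maxIntervals T.nonIdem) (hr : r ∈ Ioo I.1 I.2) :
    s ∈ Ioo I.1 I.2 ↔ ¬ ∃ e ∈ uIcc s r, e ∈ T.idem := by
  constructor
  · rintro hs ⟨e, he, hei⟩
    exact (T.mem_nonIdem_iff.1 (hI.2.1 (ordConnected_Ioo.uIcc_subset hs hr he))).2 hei
  · intro h
    by_contra hs
    rcases le_or_gt s I.1 with h1 | h1
    · exact h ⟨I.1, mem_uIcc.2 (Or.inl ⟨h1, hr.1.le⟩), left_mem_idem_of_nonIdem hI⟩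
    · exact h ⟨I.2, mem_uIcc.2 (Or.inr ⟨hr.2.le, not_lt.1 fun h2 => hs ⟨h1, h2⟩⟩),
        right_mem_idem_of_nonIdem hI⟩

theorem exists_compM_of_uIcc_subset (hne : s ≠ r) (h : uIcc s r ⊆ T.idem) :
    ∃ J ∈ T.compM, s ∈ Icc J.1 J.2 ∧ r ∈ Icc J.1 J.2 := by
  obtain ⟨J, hJ, h1, h2⟩ := exists_maxIntervals idem_subset (min_lt_max.2 hne)
    (Ioo_subset_Icc_self.trans h)
  exact ⟨J, hJ, ⟨h1.trans (min_le_left _ _), (le_max_left _ _).trans h2⟩,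
    h1.trans (min_le_right _ _), (le_max_right _ _).trans h2⟩

theorem mem_Icc_iff_of_compM (hI : I ∈ T.compM) (hr : r ∈ Icc I.1 I.2) :
    s ∈ Icc I.1 I.2 ↔ uIcc s r ⊆ T.idem := by
  refine ⟨fun hs => (ordConnected_Icc.uIcc_subset hs hr).trans (Icc_subset_idem hI), fun h => ?_⟩
  rcases eq_or_ne s r with rfl | hne
  · exact hr
  · obtain ⟨J, hJ, hs, hrJ⟩ := exists_compM_of_uIcc_subset hne h
    rwa [compM_eq_of_mem hI hJ hr hrJ]

theorem iterate_product_mem_Ioo (k : ℕ) {x : ℝ} (hx : x ∈ Ioo (0 : ℝ) 1) :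
    (fun p => product.op p p)^[k] x ∈ Ioo (0 : ℝ) 1 := by
  induction k with
  | zero => exact hx
  | succ k ih =>
    rw [Function.iterate_succ_apply']
    set y := (fun p => product.op p p)^[k] x
    have hy : product.op y y = y * y :=
      product.op_coe ⟨y, Ioo_subset_Icc_self ih⟩ ⟨y, Ioo_subset_Icc_self ih⟩
    simp only [hy]
    exact ⟨mul_pos ih.1 ih.1, mul_lt_one_of_nonneg_of_lt_one_left ih.1.le ih.2 ih.2.le⟩

/-- Squaring doubles the distance to `1` until truncation sets in, so every point below `1`
eventually reaches `0`. Squares in the product t-norm never leave the open interval. -/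
theorem iterate_lukasiewicz (k : ℕ) {x : ℝ} (hx : x ∈ Icc (0 : ℝ) 1) :
    (fun p => lukasiewicz.op p p)^[k] x = max 0 (1 - 2 ^ k * (1 - x)) := by
  induction k with
  | zero => simp [hx.1]
  | succ k ih =>
    rw [Function.iterate_succ_apply', ih]
    have hy : max 0 (1 - 2 ^ k * (1 - x)) ∈ Icc (0 : ℝ) 1 :=
      ⟨le_max_left _ _, max_le zero_le_one
        (sub_le_self _ (mul_nonneg (by positivity) (sub_nonneg.2 hx.2)))⟩
    set y := max 0 (1 - 2 ^ k * (1 - x)) with hyd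
    have hop : lukasiewicz.op y y = max 0 (y + y - 1) := lukasiewicz.op_coe ⟨y, hy⟩ ⟨y, hy⟩
    simp only [hop]
    rw [pow_succ]
    rcases max_cases 0 (1 - 2 ^ k * (1 - x)) with ⟨h1, h2⟩ | ⟨h1, h2⟩
    · rw [← hyd] at h1
      rw [h1, max_eq_left (by norm_num), max_eq_left (by linarith)]
    · rw [← hyd] at h1
      rw [h1]
      congr 1
      ring

theorem exists_iterate_lukasiewicz_eq_zero {x : ℝ} (hx : x ∈ Ioo (0 : ℝ) 1) :
    ∃ k, (fun p => lukasiewicz.op p p)^[k] x = 0 := by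
  obtain ⟨k, hk⟩ := pow_unbounded_of_one_lt (1 / (1 - x)) (one_lt_two : (1 : ℝ) < 2)
  refine ⟨k, ?_⟩
  rw [iterate_lukasiewicz k (Ioo_subset_Icc_self hx), max_eq_left]
  rw [div_lt_iff₀ (sub_pos.2 hx.2)] at hk
  linarith

theorem map_iterate_op {S₁ S₂ : ℝ → ℝ → ℝ} {a₁ b₁ a₂ b₂ : ℝ} {f : ℝ ≃o ℝ}
    (hf : IsIntervalIso S₁ S₂ a₁ b₁ a₂ b₂ f)
    (hS : ∀ p ∈ Icc a₁ b₁, S₁ p p ∈ Icc a₁ b₁) (k : ℕ) (hr : r ∈ Icc a₁ b₁) :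
    f ((fun p => S₁ p p)^[k] r) = (fun p => S₂ p p)^[k] (f r) := by
  have : (fun p => S₁ p p)^[k] r ∈ Icc a₁ b₁ ∧
      f ((fun p => S₁ p p)^[k] r) = (fun p => S₂ p p)^[k] (f r) := by
    induction k with
    | zero => exact ⟨hr, rfl⟩
    | succ k ih =>
      rw [Function.iterate_succ_apply', Function.iterate_succ_apply', ← ih.2]
      exact ⟨hS _ ih.1, hf.map_op _ ih.1 _ ih.1⟩
  exact this.2

theorem iterate_mem_nonIdem_of_compP (hI : I ∈ T.compP) (hr : r ∈ Ioo I.1 I.2) (k : ℕ) :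
    (fun p => T.op p p)^[k] r ∈ T.nonIdem := by
  have h₁ := left_mem_idem_of_nonIdem hI.1
  have h₂ := right_mem_idem_of_nonIdem hI.1
  obtain ⟨f, hf⟩ := (restrictIso_iff h₁ h₂ hI.1.1.le).1 hI.2
  have h := iterate_product_mem_Ioo k (x := f r)
    ⟨hf.map_left ▸ f.strictMono hr.1, hf.map_right ▸ f.strictMono hr.2⟩
  rw [← map_iterate_op hf (fun p hp => T.op_mem_Icc h₁ h₂ hp hp) k (Ioo_subset_Icc_self hr),
    ← hf.map_left, ← hf.map_right] at h
  exact hI.1.2.1 ⟨f.lt_iff_lt.1 h.1, f.lt_iff_lt.1 h.2⟩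

theorem exists_iterate_notMem_nonIdem_of_compL (hI : I ∈ T.compL) (hr : r ∈ Ioo I.1 I.2) :
    ∃ k, (fun p => T.op p p)^[k] r ∉ T.nonIdem := by
  have h₁ := left_mem_idem_of_nonIdem hI.1
  have h₂ := right_mem_idem_of_nonIdem hI.1
  obtain ⟨f, hf⟩ := (restrictIso_iff h₁ h₂ hI.1.1.le).1 hI.2
  obtain ⟨k, h⟩ := exists_iterate_lukasiewicz_eq_zero (x := f r)
    ⟨hf.map_left ▸ f.strictMono hr.1, hf.map_right ▸ f.strictMono hr.2⟩
  rw [← map_iterate_op hf (fun p hp => T.op_mem_Icc h₁ h₂ hp hp) k (Ioo_subset_Icc_self hr),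
    ← hf.map_left] at h
  exact ⟨k, fun hk => (T.mem_nonIdem_iff.1 hk).2 (f.injective h ▸ h₁)⟩

/-- The existence of an isomorphism is replaced by countably many conditions on one point. Its
iterated squares stay inside a product component, but reach the idempotent left end of a Łukasiewicz
one. -/
theorem mem_compP_iff (hI : I ∈ maxIntervals T.nonIdem) (hr : r ∈ Ioo I.1 I.2) :
    I ∈ T.compP ↔ ∀ k, (fun p => T.op p p)^[k] r ∈ T.nonIdem := by
  refine ⟨fun h => iterate_mem_nonIdem_of_compP h hr, fun h => ?_⟩
  refine (mem_compP_union_compL_iff.2 hI).resolve_right fun hL => ?_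
  obtain ⟨k, hk⟩ := exists_iterate_notMem_nonIdem_of_compL hL hr
  exact hk (h k)

theorem mem_compL_iff (hI : I ∈ maxIntervals T.nonIdem) (hr : r ∈ Ioo I.1 I.2) :
    I ∈ T.compL ↔ ¬ ∀ k, (fun p => T.op p p)^[k] r ∈ T.nonIdem := by
  rw [← mem_compP_iff hI hr]
  refine ⟨fun h hP => ?_, (mem_compP_union_compL_iff.2 hI).resolve_left⟩
  obtain ⟨k, hk⟩ := exists_iterate_notMem_nonIdem_of_compL h hr
  exact hk (iterate_mem_nonIdem_of_compP hP hr k)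

variable (q : ℕ ≃ Icc (0 : ℚ) 1) (n : ℕ)

/-- This treats the types P and Ł together: `P` is a type condition on the interval and `Q` its
translation into a condition on the rational with index `n`. -/
theorem exists_nonIdem_code_iff {P : ℝ × ℝ → Prop} {Q : Prop}
    (hPQ : ∀ I ∈ maxIntervals T.nonIdem, ((q n : ℚ) : ℝ) ∈ Ioo I.1 I.2 → (P I ↔ Q)) :
    (∃ I, (I ∈ maxIntervals T.nonIdem ∧ P I) ∧ T.code q I = n) ↔
      ((q n : ℚ) : ℝ) ∈ T.nonIdem ∧ Q ∧
        ∀ m < n, ∃ e ∈ uIcc ((q m : ℚ) : ℝ) (q n : ℚ), e ∈ T.idem := by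
  constructor
  · rintro ⟨I, ⟨hI, hP⟩, h⟩
    obtain ⟨h1, h2⟩ := (code_eq_iff_of_nonIdem q hI n).1 h
    refine ⟨hI.2.1 h1, (hPQ I hI h1).1 hP, fun m hm => ?_⟩
    have := h2 m hm
    rwa [mem_Ioo_iff_of_nonIdem hI h1, not_not] at this
  · rintro ⟨h1, hQ, h2⟩
    obtain ⟨I, hI, hr⟩ := exists_maxIntervals_nonIdem h1
    refine ⟨I, ⟨hI, (hPQ I hI hr).2 hQ⟩, (code_eq_iff_of_nonIdem q hI n).2 ⟨hr, fun m hm => ?_⟩⟩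
    rw [mem_Ioo_iff_of_nonIdem hI hr, not_not]
    exact h2 m hm

theorem exists_compP_code_iff : (∃ I ∈ T.compP, T.code q I = n) ↔
    ((q n : ℚ) : ℝ) ∈ T.nonIdem ∧
      (∀ k, (fun p => T.op p p)^[k] ((q n : ℚ) : ℝ) ∈ T.nonIdem) ∧
      ∀ m < n, ∃ e ∈ uIcc ((q m : ℚ) : ℝ) (q n : ℚ), e ∈ T.idem := by
  rw [← exists_nonIdem_code_iff q n (P := (· ∈ T.compP)) fun I hI hr => mem_compP_iff hI hr]
  exact exists_congr fun I => and_congr_left fun _ => ⟨fun h => ⟨h.1, h⟩, fun h => h.2⟩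

theorem exists_compL_code_iff : (∃ I ∈ T.compL, T.code q I = n) ↔
    ((q n : ℚ) : ℝ) ∈ T.nonIdem ∧
      (¬ ∀ k, (fun p => T.op p p)^[k] ((q n : ℚ) : ℝ) ∈ T.nonIdem) ∧
      ∀ m < n, ∃ e ∈ uIcc ((q m : ℚ) : ℝ) (q n : ℚ), e ∈ T.idem := by
  rw [← exists_nonIdem_code_iff q n (P := (· ∈ T.compL)) fun I hI hr => mem_compL_iff hI hr]
  exact exists_congr fun I => and_congr_left fun _ => ⟨fun h => ⟨h.1, h⟩, fun h => h.2⟩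

theorem exists_compM_code_iff : (∃ I ∈ T.compM, T.code q I = n) ↔
    (∃ j, j ≠ n ∧ uIcc ((q j : ℚ) : ℝ) (q n : ℚ) ⊆ T.idem) ∧
      ∀ m < n, ¬ uIcc ((q m : ℚ) : ℝ) (q n : ℚ) ⊆ T.idem := by
  constructor
  · rintro ⟨I, hI, h⟩
    obtain ⟨h1, h2⟩ := (code_eq_iff_of_compM q hI n).1 h
    refine ⟨?_, fun m hm => ?_⟩
    · have h0 := (idem_subset (Icc_subset_idem hI (left_mem_Icc.2 hI.1.le))).1
      have h3 := (idem_subset (Icc_subset_idem hI (right_mem_Icc.2 hI.1.le))).2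
      -- A second rational of the closed interval witnesses that it is nondegenerate. It is sought
      -- to the right of the first one, or to the left when the first one is the right end point.
      have : ∃ j, j ≠ n ∧ ((q j : ℚ) : ℝ) ∈ Icc I.1 I.2 := by
        rcases h1.2.lt_or_eq with hlt | heq
        · obtain ⟨j, hj⟩ := exists_index q (h0.trans h1.1) hlt h3
          exact ⟨j, fun h => hj.1.ne (h ▸ rfl), h1.1.trans hj.1.le, hj.2.le⟩
        · obtain ⟨j, hj⟩ := exists_index q h0 (hI.1.trans_eq heq.symm) (h1.2.trans h3)
          exact ⟨j, fun h => hj.2.ne (h ▸ rfl), hj.1.le, hj.2.le.trans h1.2⟩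
      obtain ⟨j, hj, hjI⟩ := this
      exact ⟨j, hj, (mem_Icc_iff_of_compM hI h1).1 hjI⟩
    · rw [← mem_Icc_iff_of_compM hI h1]
      exact h2 m hm
  · rintro ⟨⟨j, hj, hs⟩, h⟩
    obtain ⟨I, hI, -, hr⟩ := exists_compM_of_uIcc_subset
      (fun h => hj (index_injective q h)) hs
    refine ⟨I, hI, (code_eq_iff_of_compM q hI n).2 ⟨hr, fun m hm => ?_⟩⟩
    rw [mem_Icc_iff_of_compM hI hr]
    exact h m hm

theorem toModL1_lt_iff_codes (k : Fin 2 → ℕ) : T.toModL1 q .lt k = true ↔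
    ((∃ I ∈ T.comps, T.code q I = k 0) ∧ ∃ I ∈ T.comps, T.code q I = k 1) ∧
      (q (k 0) : ℚ) < (q (k 1) : ℚ) := by
  rw [toModL1_lt_iff]
  constructor
  · rintro ⟨I, hI, J, hJ, h1, h2, h⟩
    rw [code_lt_iff q hI hJ, h1, h2] at h
    exact ⟨⟨⟨I, hI, h1⟩, J, hJ, h2⟩, by exact_mod_cast h⟩
  · rintro ⟨⟨⟨I, hI, h1⟩, J, hJ, h2⟩, h⟩
    refine ⟨I, hI, J, hJ, h1, h2, ?_⟩
    rw [code_lt_iff q hI hJ, h1, h2]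
    exact_mod_cast h

/-! ### Measurability of the coding -/

theorem continuous_op_joint :
    Continuous fun x : ContTNorm 0 1 × ℝ × ℝ => x.1.op x.2.1 x.2.2 := by
  have h : Continuous (projIcc (0 : ℝ) 1 zero_le_one) := continuous_projIcc
  unfold op
  exact continuous_subtype_val.comp (continuous_eval.comp
    ((continuous_subtype_val.comp continuous_fst).prodMk
      ((h.comp (continuous_fst.comp continuous_snd)).prodMk
        (h.comp (continuous_snd.comp continuous_snd)))))

theorem continuous_iterate_op (k : ℕ) (r : ℝ) :
    Continuous fun T : ContTNorm 0 1 => (fun p => T.op p p)^[k] r := by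
  induction k with
  | zero => exact continuous_const
  | succ k ih =>
    simp only [Function.iterate_succ_apply']
    exact continuous_op_joint.comp (continuous_id.prodMk (ih.prodMk ih))

theorem iterate_op_mem (T : ContTNorm 0 1) (k : ℕ) {r : ℝ} (hr : r ∈ Icc (0 : ℝ) 1) :
    (fun p => T.op p p)^[k] r ∈ Icc (0 : ℝ) 1 := by
  cases k with
  | zero => exact hr
  | succ k =>
    rw [Function.iterate_succ_apply']
    exact T.op_mem _ _

theorem isOpen_iterate_mem_nonIdem (k : ℕ) {r : ℝ} (hr : r ∈ Icc (0 : ℝ) 1) :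
    IsOpen {T : ContTNorm 0 1 | (fun p => T.op p p)^[k] r ∈ T.nonIdem} := by
  have : {T : ContTNorm 0 1 | (fun p => T.op p p)^[k] r ∈ T.nonIdem} =
      {T | (fun p => T.op p p)^[k + 1] r ≠ (fun p => T.op p p)^[k] r} := by
    ext T
    change _ ∈ T.nonIdem ↔ (fun p => T.op p p)^[k + 1] r ≠ _
    rw [mem_nonIdem, Function.iterate_succ_apply']
    exact and_iff_right (T.iterate_op_mem k hr)
  rw [this]
  exact isOpen_ne_fun (continuous_iterate_op _ _) (continuous_iterate_op _ _)

/-- The quantified point ranges over a compact interval, and projection along a compact factor is a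
closed map. -/
theorem isClosed_exists_idem {r s : ℝ} (hr : r ∈ Icc (0 : ℝ) 1) (hs : s ∈ Icc (0 : ℝ) 1) :
    IsClosed {T : ContTNorm 0 1 | ∃ e ∈ uIcc s r, e ∈ T.idem} := by
  have hC : IsClosed {x : ContTNorm 0 1 × uIcc s r | x.1.op x.2 x.2 = x.2} := by
    have hc : Continuous fun x : ContTNorm 0 1 × uIcc s r => (x.2 : ℝ) :=
      continuous_subtype_val.comp continuous_snd
    exact isClosed_eq (continuous_op_joint.comp (continuous_fst.prodMk (hc.prodMk hc))) hc
  have : {T : ContTNorm 0 1 | ∃ e ∈ uIcc s r, e ∈ T.idem} =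
      Prod.fst '' {x : ContTNorm 0 1 × uIcc s r | x.1.op x.2 x.2 = x.2} := by
    ext T
    constructor
    · rintro ⟨e, he, hei⟩
      exact ⟨(T, ⟨e, he⟩), (T.mem_idem.1 hei).2, rfl⟩
    · rintro ⟨⟨T, e⟩, he, rfl⟩
      exact ⟨e, e.2, T.mem_idem.2 ⟨ordConnected_Icc.uIcc_subset hs hr e.2, he⟩⟩
  rw [this]
  have : CompactSpace (uIcc s r) := isCompact_iff_compactSpace.1 isCompact_uIcc
  exact isClosedMap_fst_of_compactSpace _ hC

theorem isClosed_uIcc_subset_idem {r s : ℝ} (hr : r ∈ Icc (0 : ℝ) 1) (hs : s ∈ Icc (0 : ℝ) 1) :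
    IsClosed {T : ContTNorm 0 1 | uIcc s r ⊆ T.idem} := by
  have : {T : ContTNorm 0 1 | uIcc s r ⊆ T.idem} =
      ⋂ e ∈ uIcc s r, {T : ContTNorm 0 1 | T.op e e = e} := by
    ext T
    simp only [mem_iInter]
    exact forall₂_congr fun e he =>
      T.mem_idem.trans (and_iff_right (ordConnected_Icc.uIcc_subset hs hr he))
  rw [this]
  exact isClosed_biInter fun e _ => isClosed_eq
    (continuous_op_joint.comp (continuous_id.prodMk (continuous_const (y := (e, e)))))
    continuous_const

section Measurable

variable [MeasurableSpace (ContTNorm 0 1)] [BorelSpace (ContTNorm 0 1)]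

theorem measurableSet_forall_exists_idem :
    MeasurableSet {T : ContTNorm 0 1 |
      ∀ m < n, ∃ e ∈ uIcc ((q m : ℚ) : ℝ) (q n : ℚ), e ∈ T.idem} := by
  have : {T : ContTNorm 0 1 | ∀ m < n, ∃ e ∈ uIcc ((q m : ℚ) : ℝ) (q n : ℚ), e ∈ T.idem} =
      ⋂ m, ⋂ _ : m < n, {T | ∃ e ∈ uIcc ((q m : ℚ) : ℝ) (q n : ℚ), e ∈ T.idem} := by
    ext T
    simp only [mem_iInter]
    exact Iff.rfl
  rw [this]
  exact MeasurableSet.iInter fun m => MeasurableSet.iInter fun _ =>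
    (isClosed_exists_idem (index_mem q n) (index_mem q m)).measurableSet

theorem measurableSet_forall_iterate :
    MeasurableSet {T : ContTNorm 0 1 |
      ∀ k, (fun p => T.op p p)^[k] ((q n : ℚ) : ℝ) ∈ T.nonIdem} := by
  have : {T : ContTNorm 0 1 | ∀ k, (fun p => T.op p p)^[k] ((q n : ℚ) : ℝ) ∈ T.nonIdem} =
      ⋂ k, {T : ContTNorm 0 1 | (fun p => T.op p p)^[k] ((q n : ℚ) : ℝ) ∈ T.nonIdem} := by
    ext T
    simp only [mem_iInter]
    exact Iff.rfl
  rw [this]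
  exact MeasurableSet.iInter fun k => (isOpen_iterate_mem_nonIdem k (index_mem q n)).measurableSet

theorem measurableSet_compP_code :
    MeasurableSet {T : ContTNorm 0 1 | ∃ I ∈ T.compP, T.code q I = n} := by
  simp only [exists_compP_code_iff]
  -- The iterate of index `0` is the rational itself.
  exact (isOpen_iterate_mem_nonIdem 0 (index_mem q n)).measurableSet.inter
    ((measurableSet_forall_iterate q n).inter (measurableSet_forall_exists_idem q n))

theorem measurableSet_compL_code :
    MeasurableSet {T : ContTNorm 0 1 | ∃ I ∈ T.compL, T.code q I = n} := by
  simp only [exists_compL_code_iff]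
  exact (isOpen_iterate_mem_nonIdem 0 (index_mem q n)).measurableSet.inter
    ((measurableSet_forall_iterate q n).compl.inter (measurableSet_forall_exists_idem q n))

theorem measurableSet_compM_code :
    MeasurableSet {T : ContTNorm 0 1 | ∃ I ∈ T.compM, T.code q I = n} := by
  have hC : ∀ m, MeasurableSet {T : ContTNorm 0 1 | uIcc ((q m : ℚ) : ℝ) (q n : ℚ) ⊆ T.idem} :=
    fun m => (isClosed_uIcc_subset_idem (index_mem q n) (index_mem q m)).measurableSet
  have : {T : ContTNorm 0 1 | ∃ I ∈ T.compM, T.code q I = n} =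
      (⋃ j, ⋃ _ : j ≠ n, {T : ContTNorm 0 1 | uIcc ((q j : ℚ) : ℝ) (q n : ℚ) ⊆ T.idem}) ∩
      ⋂ m, ⋂ _ : m < n, {T : ContTNorm 0 1 | uIcc ((q m : ℚ) : ℝ) (q n : ℚ) ⊆ T.idem}ᶜ := by
    ext T
    simp only [mem_inter_iff, mem_iUnion, mem_iInter, exists_prop]
    exact exists_compM_code_iff q n
  rw [this]
  exact (MeasurableSet.iUnion fun j => MeasurableSet.iUnion fun _ => hC j).inter
    (MeasurableSet.iInter fun m => MeasurableSet.iInter fun _ => (hC m).compl)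

theorem measurableSet_comps_code :
    MeasurableSet {T : ContTNorm 0 1 | ∃ I ∈ T.comps, T.code q I = n} := by
  have : {T : ContTNorm 0 1 | ∃ I ∈ T.comps, T.code q I = n} =
      ({T | ∃ I ∈ T.compP, T.code q I = n} ∪ {T | ∃ I ∈ T.compL, T.code q I = n}) ∪
        {T | ∃ I ∈ T.compM, T.code q I = n} := by
    ext T
    constructor
    · rintro ⟨I, (hI | hI) | hI, h⟩
      exacts [Or.inl (Or.inl ⟨I, hI, h⟩), Or.inl (Or.inr ⟨I, hI, h⟩), Or.inr ⟨I, hI, h⟩]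
    · rintro ((⟨I, hI, h⟩ | ⟨I, hI, h⟩) | ⟨I, hI, h⟩)
      exacts [⟨I, Or.inl (Or.inl hI), h⟩, ⟨I, Or.inl (Or.inr hI), h⟩, ⟨I, Or.inr hI, h⟩]
  rw [this]
  exact ((measurableSet_compP_code q n).union (measurableSet_compL_code q n)).union
    (measurableSet_compM_code q n)

theorem measurableSet_toModL1 (i : L1Symbol) (k : Fin i.arity → ℕ) :
    MeasurableSet {T : ContTNorm 0 1 | T.toModL1 q i k = true} := by
  cases i with
  | lt =>
    have : {T : ContTNorm 0 1 | T.toModL1 q .lt k = true} =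
        ({T | ∃ I ∈ T.comps, T.code q I = k (0 : Fin 2)} ∩
          {T | ∃ I ∈ T.comps, T.code q I = k (1 : Fin 2)}) ∩
        {_T | (q (k (0 : Fin 2)) : ℚ) < (q (k (1 : Fin 2)) : ℚ)} := by
      ext T
      exact toModL1_lt_iff_codes q k
    rw [this]
    exact ((measurableSet_comps_code q _).inter (measurableSet_comps_code q _)).inter
      (MeasurableSet.const _)
  | P =>
    have : {T : ContTNorm 0 1 | T.toModL1 q .P k = true} =
        {T | ∃ I ∈ T.compP, T.code q I = k (0 : Fin 1)} := by
      ext T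
      exact toModL1_P_iff q k
    rw [this]
    exact measurableSet_compP_code q _
  | L =>
    have : {T : ContTNorm 0 1 | T.toModL1 q .L k = true} =
        {T | ∃ I ∈ T.compL, T.code q I = k (0 : Fin 1)} := by
      ext T
      exact toModL1_L_iff q k
    rw [this]
    exact measurableSet_compL_code q _
  | M =>
    have : {T : ContTNorm 0 1 | T.toModL1 q .M k = true} =
        {T | ∃ I ∈ T.compM, T.code q I = k (0 : Fin 1)} := by
      ext T
      exact toModL1_M_iff q k
    rw [this]
    exact measurableSet_compM_code q _

theorem measurable_toModL1 : Measurable (toModL1 q) :=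
  measurable_pi_iff.2 fun i => measurable_pi_iff.2 fun k =>
    measurable_to_bool (measurableSet_toModL1 q i k)

end Measurable

/-! ### The Borel reduction -/

theorem isBorelReduction_toModL1 :
    IsBorelReduction isoSetoid (ModSpace.isoSetoid L1Symbol.arity) (toModL1 q) where
  borel_map := by
    borelize (ContTNorm 0 1)
    have : Countable L1Symbol := Finite.to_countable
    -- All index sets are countable, so the Borel σ-algebra is the product one and measurability can
    -- be tested coordinatewise.
    rw [← (inferInstance : BorelSpace ModL1).measurable_eq]
    exact measurable_toModL1 q
  reduction _ _ := ⟨toModL1_iso_of_iso q, iso_of_toModL1_iso q⟩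

end ContTNorm

/-- `(𝒯, ≅_t) ≤_B (Mod(L₁), ≅_{L₁})`; and for each non-repeating enumeration `q` of the rationals
of `[0, 1]`, the coding of a t-norm by its labelled ordered set of components is such a
reduction. -/
theorem proposition4p2 :
    BorelReducible ContTNorm.isoSetoid (ModSpace.isoSetoid L1Symbol.arity) ∧
    ∀ q : ℕ ≃ Set.Icc (0 : ℚ) 1,
      IsBorelReduction ContTNorm.isoSetoid (ModSpace.isoSetoid L1Symbol.arity)
        (ContTNorm.toModL1 q) := by
  refine ⟨?_, fun q => ContTNorm.isBorelReduction_toModL1 q⟩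
  have : Infinite (Set.Icc (0 : ℚ) 1) := (Set.Icc_infinite zero_lt_one).to_subtype
  obtain ⟨d⟩ := nonempty_denumerable (Set.Icc (0 : ℚ) 1)
  exact ⟨_, ContTNorm.isBorelReduction_toModL1 (Denumerable.eqv _).symm⟩
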